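/- Write elements of $\mathbb{C}^4$ as $(u_1,v_1,u_2,v_2)$ and a matrix $M\in\mathrm{GL}_4(\mathbb{Q})$ in $2\times2$ blocks $M=\begin{pmatrix}A_1&A_2\\A_3&A_4\end{pmatrix}$. Let $\mathfrak{m}_M(x)\in\mathbb{Q}[x]$ be the minimal polynomial of $M$, and let $\iota=I\oplus(-I)$ ($2\times 2$ blocks). A *generalized analytic holonomy set* with cusp shapes $\tau_1,\tau_2$ is the germ at the origin of an analytic set $\mathcal{X}=\{(u_1,v_1(u_1,u_2),u_2,v_2(u_1,u_2))\}\subset\mathbb{C}^4$, where $v_i(u_1,u_2)=\tau_iu_i+(\text{terms of odd total degree}\ge 3)$ $(i=1,2)$ are holomorphic near the origin and satisfy: - $\mathrm{Im}\,\tau_i>0$; - $v_1(u_1,0)\not\equiv\tau_1u_1$ and $v_2(0,u_2)\not\equiv\tau_2u_2$; - $v_1$ is odd in $u_1$ and even in $u_2$; $v_2$ is even in $u_1$ and odd in $u_2$; - $\partial v_1/\partial u_2=a\,\partial v_2/\partial u_1$ for some $a\in\mathbb{C}$; - every subgroup of $\mathrm{Aut}\,\mathcal{X}$ contained in $\mathrm{GL}_4(\mathbb{Q})$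 is finite. (Here $M\in\mathrm{GL}_4(\mathbb{Q})$ belongs to $\mathrm{Aut}\,\mathcal{X}$ if $\mathbf{x}\mapsto M\mathbf{x}$ maps the germ $\mathcal{X}$ onto itself.) A matrix $M\in\mathrm{GL}_4(\mathbb{Q})$ is of *Type I* if $\det A_1=\det A_4=1$ and $A_2=A_3=0$; of *Type II* if $\det A_2=\det A_3=1$ and $A_1=A_4=0$; of *Type III* if all $\det A_j\neq0$, $\det A_1=\det A_4$, $\det A_2=\det A_3$, $\det A_1+\det A_3=1$ and $(\det A_1)A_1^{-1}A_2=-(\det A_3)A_3^{-1}A_4$. **Theorem.** Let $\mathcal{X}$ be a generalized analytic holonomy set whose cusp shapes lie in $\mathbb{Q}(\sqrt{-1})$, and let $\mathcal{G}$ be the subgroup of $\mathrm{Aut}\,\mathcal{X}$ generated by its elements of Types I, II and III in $\mathrm{GL}_4(\mathbb{Q})$. 1. If $\mathcal{G}$ contains an element $M$ of Type III with $\mathfrak{m}_M(x)=x^2+1$, then $\mathcal{G}=\langle M,\pm\iota\rangle$, and $$\mathcal{G}=\{\pm\iota^{\epsilon_1}(\iota M)^{\alpha}\iota^{\epsilon_2}\;:\;0\le\epsilon_1,\epsilon_2\le1,\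 0\le\alpha\le5\}.$$ 2. If $\mathcal{G}$ contains Type III elements $M$ and $N$ such that $\mathfrak{m}_M(x)$ is $x^3+x^2+x+1$ or $x^3-x^2+x-1$, $\mathfrak{m}_N(x)=x^4-x^2+1$, and $\mathfrak{m}_{\iota N}(x)$ is $x^2+x+1$ or $x^2-x+1$, then $\mathcal{G}=\langle M,N,\pm\iota\rangle$. Moreover, $\mathcal{G}$ contains an abelian subgroup $\mathcal{H}$ of order $16$, all of whose elements are of Type I, such that $$\mathcal{G}=\{\eta_1M^{\alpha}\eta_2\;:\;\eta_1,\eta_2\in\mathcal{H},\ 0\le\alpha\le2\}.$$ -/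

import Mathlib

open Topology Matrix Polynomial

namespace GHol

/-- Invertible rational `4 × 4` matrices, with the four coordinates ordered as
`(u₁, v₁ | u₂, v₂)`, so that a matrix comes with its four `2 × 2` blocks
`A₁ = toBlocks₁₁`, `A₂ = toBlocks₁₂`, `A₃ = toBlocks₂₁`, `A₄ = toBlocks₂₂`. -/
abbrev GL4 : Type := GL (Fin 2 ⊕ Fin 2) ℚ

/-- The space `ℂ⁴` with coordinates `u₁ = x (inl 0)`, `v₁ = x (inl 1)`, `u₂ = x (inr 0)`,
`v₂ = x (inr 1)`. -/
abbrev C4 : Type := Fin 2 ⊕ Fin 2 → ℂ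

/-- The analytic set `{(u₁, v₁(u₁,u₂), u₂, v₂(u₁,u₂))}` in `ℂ⁴`; only its germ at the
origin matters below. -/
def graphSet (v₁ v₂ : ℂ × ℂ → ℂ) : Set C4 :=
  {x | x (Sum.inl 1) = v₁ (x (Sum.inl 0), x (Sum.inr 0)) ∧
       x (Sum.inr 1) = v₂ (x (Sum.inl 0), x (Sum.inr 0))}

/-- The linear action of a rational matrix on `ℂ⁴`. -/
noncomputable def act (M : GL4) (x : C4) : C4 :=
  (M : Matrix (Fin 2 ⊕ Fin 2) (Fin 2 ⊕ Fin 2) ℚ).map (algebraMap ℚ ℂ) *ᵥ x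

theorem act_one (x : C4) : act 1 x = x := by
  simp [act]

theorem act_mul (M N : GL4) (x : C4) : act (M * N) x = act M (act N x) := by
  simp [act, Matrix.map_mul, Matrix.mulVec_mulVec]

theorem tendsto_act (M : GL4) : Filter.Tendsto (act M) (𝓝 0) (𝓝 0) := by
  have h : Continuous (act M) := by
    unfold act
    exact Continuous.matrix_mulVec continuous_const continuous_id
  have h0 : act M 0 = 0 := by simp [act]
  have := h.tendsto 0
  rwa [h0] at this

/-- The elements of the automorphism group of (the germ at `0` of) `X` which are given by
matrices in `GL₄(ℚ)`: those `M` for which `x ↦ M x` maps the germ of `X` at the origin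
onto itself. -/
def ratAut (X : Set C4) : Subgroup GL4 where
  carrier := {M | ∀ᶠ x in 𝓝 (0 : C4), act M x ∈ X ↔ x ∈ X}
  one_mem' := by simp [act_one]
  mul_mem' := by
    intro M N hM hN
    filter_upwards [hN, (tendsto_act N).eventually hM] with x hx hx'
    rw [act_mul, hx', hx]
  inv_mem' := by
    intro M hM
    filter_upwards [(tendsto_act M⁻¹).eventually hM] with x hx
    rw [← hx, ← act_mul, mul_inv_cancel, act_one]

/-- `X = graphSet v₁ v₂` is a generalized analytic holonomy set with cusp shapes `τ₁, τ₂`. -/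
structure IsGHol (v₁ v₂ : ℂ × ℂ → ℂ) (τ₁ τ₂ : ℂ) : Prop where
  /-- The first six conditions say that, near the origin,
  `vᵢ = τᵢ uᵢ + ∑ (homogeneous terms of odd degree ≥ 3)`, a convergent power series. -/
  analytic₁ : AnalyticAt ℂ v₁ 0
  analytic₂ : AnalyticAt ℂ v₂ 0
  linear₁ : HasFDerivAt v₁ (τ₁ • ContinuousLinearMap.fst ℂ ℂ ℂ) 0
  linear₂ : HasFDerivAt v₂ (τ₂ • ContinuousLinearMap.snd ℂ ℂ ℂ) 0
  odd₁ : ∀ᶠ u in 𝓝 (0 : ℂ × ℂ), v₁ (-u) = -v₁ u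
  odd₂ : ∀ᶠ u in 𝓝 (0 : ℂ × ℂ), v₂ (-u) = -v₂ u
  im_pos₁ : 0 < τ₁.im
  im_pos₂ : 0 < τ₂.im
  nonlinear₁ : ¬ ∀ᶠ z in 𝓝 (0 : ℂ), v₁ (z, 0) = τ₁ * z
  nonlinear₂ : ¬ ∀ᶠ z in 𝓝 (0 : ℂ), v₂ (0, z) = τ₂ * z
  symm₁₂ : ∀ᶠ u in 𝓝 (0 : ℂ × ℂ), v₁ (u.1, -u.2) = v₁ u
  symm₁₁ : ∀ᶠ u in 𝓝 (0 : ℂ × ℂ), v₁ (-u.1, u.2) = -v₁ u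
  symm₂₁ : ∀ᶠ u in 𝓝 (0 : ℂ × ℂ), v₂ (-u.1, u.2) = v₂ u
  symm₂₂ : ∀ᶠ u in 𝓝 (0 : ℂ × ℂ), v₂ (u.1, -u.2) = -v₂ u
  /-- `∂v₁/∂u₂ = a ∂v₂/∂u₁` for some constant `a`. -/
  partials : ∃ a : ℂ, ∀ᶠ u in 𝓝 (0 : ℂ × ℂ),
    fderiv ℂ v₁ u (0, 1) = a * fderiv ℂ v₂ u (1, 0)
  /-- Every group of automorphisms contained in `GL₄(ℚ)` is finite. -/
  finite_aut : ∀ K : Subgroup GL4, K ≤ ratAut (graphSet v₁ v₂) → (K : Set GL4).Finite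

/-- The block `A₁`. -/
def A₁ (M : GL4) : Matrix (Fin 2) (Fin 2) ℚ := M.val.toBlocks₁₁
/-- The block `A₂`. -/
def A₂ (M : GL4) : Matrix (Fin 2) (Fin 2) ℚ := M.val.toBlocks₁₂
/-- The block `A₃`. -/
def A₃ (M : GL4) : Matrix (Fin 2) (Fin 2) ℚ := M.val.toBlocks₂₁
/-- The block `A₄`. -/
def A₄ (M : GL4) : Matrix (Fin 2) (Fin 2) ℚ := M.val.toBlocks₂₂

/-- Type I. -/
def TypeI (M : GL4) : Prop :=
  (A₁ M).det = 1 ∧ (A₄ M).det = 1 ∧ A₂ M = 0 ∧ A₃ M = 0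

/-- Type II. -/
def TypeII (M : GL4) : Prop :=
  (A₃ M).det = 1 ∧ (A₂ M).det = 1 ∧ A₁ M = 0 ∧ A₄ M = 0

/-- Type III. -/
def TypeIII (M : GL4) : Prop :=
  ((A₁ M).det ≠ 0 ∧ (A₂ M).det ≠ 0 ∧ (A₃ M).det ≠ 0 ∧ (A₄ M).det ≠ 0) ∧
  (A₁ M).det = (A₄ M).det ∧ (A₂ M).det = (A₃ M).det ∧ (A₁ M).det + (A₃ M).det = 1 ∧
  (A₁ M).det • ((A₁ M)⁻¹ * A₂ M) = -((A₃ M).det • ((A₃ M)⁻¹ * A₄ M))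

/-- The subgroup of `Aut X` generated by its elements of Types I, II and III. -/
def typeGroup (v₁ v₂ : ℂ × ℂ → ℂ) : Subgroup GL4 :=
  Subgroup.closure
    {M | M ∈ ratAut (graphSet v₁ v₂) ∧ (TypeI M ∨ TypeII M ∨ TypeIII M)}

/-- The matrix `ι = I ⊕ (-I)`. -/
def iota : GL4 where
  val := Matrix.fromBlocks 1 0 0 (-1)
  inv := Matrix.fromBlocks 1 0 0 (-1)
  val_inv := by simp [Matrix.fromBlocks_multiply]
  inv_val := by simp [Matrix.fromBlocks_multiply]

/-- The minimal polynomial over `ℚ` of a matrix. -/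
noncomputable def minPoly (M : GL4) : ℚ[X] := minpoly ℚ M.val

end GHol

/-!
An automorphism of the germ `X` preserves its tangent plane `{(x, τ₁ x, y, τ₂ y)}` at the origin,
and since `τ₁` and `τ₂` are not real, a rational matrix is determined by its action there. This
gives a faithful representation `tangentRep` of the group on `ℂ²`. Matrices of Types I, II and III all
preserve the symplectic form `symp₄` (`isSymplectic_of_type`), which restricts to `2 i` times a
positive definite Hermitian form on the tangent plane. In a suitable basis the group thus becomes a
finite group `G` of unitary `2 × 2` matrices, and because the cusp shapes lie in `ℚ(i)`, so do the
diagonal entries (`gaussianRep_tangentRep`).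

For such a group containing `ι = diag(1, -1)`, traces are algebraic integers of `ℚ(i)`, that is,
Gaussian integers. Comparing `g` with `ι g`, twice a diagonal entry is a Gaussian integer; comparing
`g h` with `g ι h`, so is four times a product of off-diagonal entries of `g` and `h`
(`GaussianRep.two_mul_diag_mem`, `GaussianRep.four_mul_offdiag_mem`). For a unitary `g` with corner
entry `x`, put `k = |2 x| ^ 2 ∈ {0, 1, 2, 3, 4}`.

* If `M ^ 2 = -1`, the corner entry of `M` is `±i/2`, and `k` and `12 - 3 k` are sums of two
  squares, whence `k = 4` (`g` is diagonal) or `k = 1` (`g` has the entries of `M` up to units).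
  Integrality again determines the units, and `(ι M) ^ 3 = ±i` supplies the scalars
  (`GaussianRep.exists_eq_of_sq_eq_neg`).
* If `M` satisfies the cubic relation, Cayley–Hamilton shows that its corner entries are equal, of
  squared norm `1/2`, and that `M ^ 2` is antidiagonal. Then `k` and `8 - 2 k` are sums of two
  squares, so that `k ∈ {4, 2, 0}`, and `g` lies in `H`, `H M H` or `H M ^ 2`, where `H` consists of
  the diagonal elements. The element `N` provides the scalar `N ^ 3 = ±i` and a diagonal matrix with
  entries `1, ±i`, so `H` contains all diagonal matrices of fourth roots of unity
  (`GaussianRep.structure_of_cubic_quartic`).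
-/

namespace GHol

/-! ### Gaussian integers inside `ℂ` -/

/-- The ring `ℤ[i]` as a subring of `ℂ`. -/
abbrev gaussInt : Subring ℂ := GaussianInt.toComplex.range

theorem mem_gaussInt {w : ℂ} : w ∈ gaussInt ↔ ∃ m n : ℤ, w = m + n * Complex.I := by
  constructor
  · rintro ⟨x, rfl⟩
    exact ⟨x.re, x.im, GaussianInt.toComplex_def x⟩
  · rintro ⟨m, n, rfl⟩
    exact ⟨⟨m, n⟩, GaussianInt.toComplex_def' m n⟩

theorem exists_normSq_eq {w : ℂ} (hw : w ∈ gaussInt) :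
    ∃ m n : ℤ, w = m + n * Complex.I ∧ Complex.normSq w = ((m ^ 2 + n ^ 2 : ℤ) : ℝ) := by
  obtain ⟨m, n, rfl⟩ := mem_gaussInt.1 hw
  refine ⟨m, n, rfl, ?_⟩
  simp [Complex.normSq_apply]
  ring

theorem four_mul_normSq_ne_one {w : ℂ} (hw : w ∈ gaussInt) : 4 * Complex.normSq w ≠ 1 := by
  obtain ⟨m, n, -, h⟩ := exists_normSq_eq hw
  rw [h]
  intro h
  have : 4 * (m ^ 2 + n ^ 2) = 1 := by exact_mod_cast h
  omega

theorem sq_add_sq_ne {m n : ℤ} : m ^ 2 + n ^ 2 ≠ 6 ∧ m ^ 2 + n ^ 2 ≠ 12 ∧ m ^ 2 + n ^ 2 ≠ 3 := by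
  refine ⟨fun h ↦ ?_, fun h ↦ ?_, fun h ↦ ?_⟩ <;>
  · have h1 : m ≤ 3 := by nlinarith
    have h2 : -3 ≤ m := by nlinarith
    have h3 : n ≤ 3 := by nlinarith
    have h4 : -3 ≤ n := by nlinarith
    interval_cases m <;> interval_cases n <;> omega

/-- Gaussian integers of the same norm `1`, `2`, `4` or `9` differ by a unit; in each case this is
visible on fourth powers. -/
theorem pow_four_of_normSq {w : ℂ} (hw : w ∈ gaussInt) :
    (Complex.normSq w = 1 → w ^ 4 = 1) ∧ (Complex.normSq w = 2 → w ^ 4 = -4) ∧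
      (Complex.normSq w = 4 → w ^ 4 = 16) ∧ (Complex.normSq w = 9 → w ^ 4 = 81) := by
  obtain ⟨m, n, rfl, h⟩ := exists_normSq_eq hw
  have key : ((m : ℂ) + n * Complex.I) ^ 4 =
      ((m ^ 4 - 6 * m ^ 2 * n ^ 2 + n ^ 4 : ℤ) : ℂ) +
        ((4 * m * n * (m ^ 2 - n ^ 2) : ℤ) : ℂ) * Complex.I := by
    push_cast
    linear_combination (6 * (m : ℂ) ^ 2 * n ^ 2 + 4 * m * n ^ 3 * Complex.I +
      n ^ 4 * (Complex.I ^ 2 - 1)) * Complex.I_sq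
  rw [h, key]
  refine ⟨fun h ↦ ?_, fun h ↦ ?_, fun h ↦ ?_, fun h ↦ ?_⟩
  all_goals
    have h0 : m ^ 2 + n ^ 2 ≤ 9 := by
      have h' : ((m ^ 2 + n ^ 2 : ℤ) : ℝ) ≤ ((9 : ℤ) : ℝ) := by rw [h]; norm_num
      exact_mod_cast h'
    have h1 : m ≤ 3 := by nlinarith
    have h2 : -3 ≤ m := by nlinarith
    have h3 : n ≤ 3 := by nlinarith
    have h4 : -3 ≤ n := by nlinarith
    clear h0 key hw
    norm_cast at h
    interval_cases m <;> interval_cases n <;>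
      first
      | (exfalso; revert h; norm_num; done)
      | norm_num

theorem pow_four_eq_one {s : ℂ} (hs : s ^ 4 = 1) :
    s = 1 ∨ s = -1 ∨ s = Complex.I ∨ s = -Complex.I := by
  have : (s - 1) * ((s + 1) * ((s - Complex.I) * (s + Complex.I))) = 0 := by
    linear_combination hs + (1 - s ^ 2) * Complex.I_sq
  rcases mul_eq_zero.1 this with h | h
  · exact Or.inl (sub_eq_zero.1 h)
  rcases mul_eq_zero.1 h with h | h
  · exact Or.inr (Or.inl (eq_neg_of_add_eq_zero_left h))
  rcases mul_eq_zero.1 h with h | h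
  · exact Or.inr (Or.inr (Or.inl (sub_eq_zero.1 h)))
  · exact Or.inr (Or.inr (Or.inr (eq_neg_of_add_eq_zero_left h)))

theorem sq_eq_one_or_neg_one {s : ℂ} (hs : s ^ 4 = 1) : s ^ 2 = 1 ∨ s ^ 2 = -1 := by
  have h : (s ^ 2 - 1) * (s ^ 2 + 1) = 0 := by linear_combination hs
  exact (mul_eq_zero.1 h).imp sub_eq_zero.1 eq_neg_of_add_eq_zero_left

theorem exists_eq_pow {t u : ℂ} (ht : t ^ 2 = -1) (hu : u ^ 4 = 1) : ∃ k : ℕ, u = t ^ k := by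
  have : (u - 1) * ((u + 1) * ((u - t) * (u + t))) = 0 := by
    linear_combination hu + (1 - u ^ 2) * ht
  rcases mul_eq_zero.1 this with h | h
  · exact ⟨0, by simpa using sub_eq_zero.1 h⟩
  rcases mul_eq_zero.1 h with h | h
  · exact ⟨2, by rw [ht]; exact eq_neg_of_add_eq_zero_left h⟩
  rcases mul_eq_zero.1 h with h | h
  · exact ⟨1, by simpa using sub_eq_zero.1 h⟩
  · exact ⟨3, by linear_combination h - t * ht⟩

/-- An algebraic integer in `ℚ(i)` is a Gaussian integer. -/
theorem mem_gaussInt_of_isIntegral {w : ℂ} {q r : ℚ} (hw : w = q + r * Complex.I)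
    (h : IsIntegral ℤ w) : w ∈ gaussInt := by
  have hc : IsIntegral ℤ (starRingEnd ℂ w) := by
    simpa using h.map ((starRingEnd ℂ).toIntAlgHom)
  have hcw : starRingEnd ℂ w = q - r * Complex.I := by
    rw [hw]; simp [sub_eq_add_neg]
  have hI : IsIntegral ℤ Complex.I := by
    refine IsIntegral.of_pow (n := 2) (by norm_num) ?_
    rw [Complex.I_sq]
    exact isIntegral_one.neg
  have down : ∀ x : ℚ, IsIntegral ℤ (x : ℂ) → ∃ n : ℤ, (n : ℚ) = x := by
    intro x hx
    have : IsIntegral ℤ x := by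
      have := (isIntegral_algebraMap_iff (A := ℚ) (B := ℂ) (R := ℤ)
        (algebraMap ℚ ℂ).injective (x := x)).1 (by simpa using hx)
      exact this
    obtain ⟨n, hn⟩ := IsIntegrallyClosed.isIntegral_iff.1 this
    exact ⟨n, by simpa using hn⟩
  obtain ⟨m, hm⟩ := down (2 * q) (by
    have e : ((2 * q : ℚ) : ℂ) = w + starRingEnd ℂ w := by rw [hcw, hw]; push_cast; ring
    rw [e]; exact h.add hc)
  obtain ⟨n, hn⟩ := down (2 * r) (by
    have e : ((2 * r : ℚ) : ℂ) = Complex.I * (starRingEnd ℂ w - w) := by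
      rw [hcw, hw]; push_cast; linear_combination 2 * (r : ℂ) * Complex.I_sq
    rw [e]; exact hI.mul (hc.sub h))
  obtain ⟨k, hk⟩ := down (q ^ 2 + r ^ 2) (by
    have e : ((q ^ 2 + r ^ 2 : ℚ) : ℂ) = w * starRingEnd ℂ w := by
      rw [hcw, hw]; push_cast; linear_combination (r : ℂ) ^ 2 * Complex.I_sq
    rw [e]; exact h.mul hc)
  have hmn : m ^ 2 + n ^ 2 = 4 * k := by
    have : (m : ℚ) ^ 2 + n ^ 2 = 4 * k := by rw [hm, hn, hk]; ring
    exact_mod_cast this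
  have hev : ∀ a b : ℤ, a ^ 2 + b ^ 2 = 4 * k → Even a := by
    intro a b hab
    by_contra ha
    rw [Int.not_even_iff_odd] at ha
    obtain ⟨c, rfl⟩ := ha
    rcases Int.even_or_odd b with ⟨d, rfl⟩ | ⟨d, rfl⟩
    · ring_nf at hab; omega
    · ring_nf at hab; omega
  obtain ⟨m', rfl⟩ := hev m n hmn
  obtain ⟨n', rfl⟩ := hev n (m' + m') (by rw [add_comm, hmn])
  refine mem_gaussInt.2 ⟨m', n', ?_⟩
  have hq : q = m' := by push_cast at hm; linarith
  have hr : r = n' := by push_cast at hn; linarith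
  rw [hw, hq, hr]
  simp

/-- The trace of a matrix of finite order is a sum of roots of unity. -/
theorem isIntegral_trace_of_pow_eq_one {A : Matrix (Fin 2) (Fin 2) ℂ} {n : ℕ} (hn : n ≠ 0)
    (h : A ^ n = 1) : IsIntegral ℤ A.trace := by
  rw [Matrix.trace_eq_sum_roots_charpoly]
  refine IsIntegral.multiset_sum fun x hx ↦ ?_
  have hx' := spectrum.pow_mem_pow A n
    (Matrix.mem_spectrum_iff_isRoot_charpoly.2 (Polynomial.isRoot_of_mem_roots hx))
  rw [h, spectrum.one_eq, Set.mem_singleton_iff] at hx'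
  exact IsIntegral.of_pow (Nat.pos_of_ne_zero hn) (hx' ▸ isIntegral_one)

/-! ### Finite groups of unitary matrices with diagonal entries in `ℚ(i)` -/

/-- A faithful unitary representation of `G` on `ℂ²` whose diagonal entries lie in `ℚ(i)`, together
with elements `ι` and `z` acting by `diag(1, -1)` and by `-1`. -/
structure GaussianRep {G : Type*} [Group G] (ρ : G →* Matrix (Fin 2) (Fin 2) ℂ) (ι z : G) :
    Prop where
  injective : Function.Injective ρ
  unitary : ∀ g, (ρ g)ᴴ * ρ g = 1
  diag : ∀ g i, ∃ q r : ℚ, ρ g i i = q + r * Complex.I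
  map_iota : ρ ι = !![1, 0; 0, -1]
  map_neg : ρ z = -1

namespace GaussianRep

open Complex
open scoped ComplexConjugate

variable {G : Type*} [Group G] {ρ : G →* Matrix (Fin 2) (Fin 2) ℂ} {ι z : G}

theorem mul_apply (g h : G) (i j : Fin 2) :
    ρ (g * h) i j = ρ g i 0 * ρ h 0 j + ρ g i 1 * ρ h 1 j := by
  rw [map_mul, Matrix.mul_apply, Fin.sum_univ_two]

theorem conj_relations (hρ : GaussianRep ρ ι z) (g : G) :
    ρ g 1 1 = (ρ g).det * conj (ρ g 0 0) ∧ ρ g 1 0 = -((ρ g).det * conj (ρ g 0 1)) := by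
  have h1 : ρ g * (ρ g)ᴴ = 1 := mul_eq_one_comm.1 (hρ.unitary g)
  have h2 : (ρ g).adjugate = (ρ g).det • (ρ g)ᴴ := by
    calc (ρ g).adjugate = (ρ g).adjugate * (ρ g * (ρ g)ᴴ) := by rw [h1, mul_one]
      _ = _ := by rw [← mul_assoc, Matrix.adjugate_mul, smul_mul_assoc, one_mul]
  rw [Matrix.adjugate_fin_two] at h2
  have e1 := congrFun (congrFun h2 0) 0
  have e2 := congrFun (congrFun h2 1) 0
  simp at e1 e2
  exact ⟨by simpa using e1, by rw [← e2, neg_neg]⟩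

theorem normSq_relations (hρ : GaussianRep ρ ι z) (g : G) :
    normSq (ρ g 0 1) = 1 - normSq (ρ g 0 0) ∧ normSq (ρ g 1 0) = 1 - normSq (ρ g 0 0) ∧
      normSq (ρ g 1 1) = normSq (ρ g 0 0) ∧ normSq (ρ g).det = 1 := by
  have h1 : ρ g * (ρ g)ᴴ = 1 := mul_eq_one_comm.1 (hρ.unitary g)
  have e1 := congrFun (congrFun h1 0) 0
  have hD : normSq (ρ g).det = 1 := by
    have := congrArg Matrix.det h1
    rw [Matrix.det_mul, Matrix.det_conjTranspose, Matrix.det_one] at this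
    have h' : (normSq (ρ g).det : ℂ) = 1 := by rw [← this, ← mul_conj]; rfl
    exact_mod_cast h'
  rw [Matrix.mul_apply, Fin.sum_univ_two] at e1
  simp only [Matrix.conjTranspose_apply, Matrix.one_apply_eq, ← starRingEnd_apply, mul_conj] at e1
  have e1' : normSq (ρ g 0 0) + normSq (ρ g 0 1) = 1 := by exact_mod_cast e1
  obtain ⟨h3, h4⟩ := hρ.conj_relations g
  rw [h3, h4]
  simp only [normSq_neg, map_mul, normSq_conj, hD, one_mul]
  refine ⟨?_, ?_, trivial, trivial⟩ <;> linarith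

theorem iota_mul_apply (hρ : GaussianRep ρ ι z) (g : G) (j : Fin 2) :
    ρ (ι * g) 0 j = ρ g 0 j ∧ ρ (ι * g) 1 j = -ρ g 1 j := by
  rw [mul_apply, mul_apply, hρ.map_iota]
  simp

variable [Finite G]

theorem trace_mem (hρ : GaussianRep ρ ι z) (g : G) : ρ g 0 0 + ρ g 1 1 ∈ gaussInt := by
  obtain ⟨q, r, h0⟩ := hρ.diag g 0
  obtain ⟨q', r', h1⟩ := hρ.diag g 1
  refine mem_gaussInt_of_isIntegral (q := q + q') (r := r + r') ?_ ?_
  · rw [h0, h1]; push_cast; ring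
  · rw [← Matrix.trace_fin_two]
    refine isIntegral_trace_of_pow_eq_one (n := orderOf g) (orderOf_pos g).ne' ?_
    rw [← map_pow, pow_orderOf_eq_one, map_one]

theorem trace_iota_mul_mem (hρ : GaussianRep ρ ι z) (g : G) :
    ρ g 0 0 - ρ g 1 1 ∈ gaussInt := by
  have := hρ.trace_mem (ι * g)
  rwa [(hρ.iota_mul_apply g 0).1, (hρ.iota_mul_apply g 1).2, ← sub_eq_add_neg] at this

/-- Diagonal entries are half-integral, because both `g` and `ι g` have integral trace. -/
theorem two_mul_diag_mem (hρ : GaussianRep ρ ι z) (g : G) :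
    2 * ρ g 0 0 ∈ gaussInt ∧ 2 * ρ g 1 1 ∈ gaussInt := by
  have h1 := hρ.trace_mem g
  have h2 := hρ.trace_iota_mul_mem g
  constructor
  · convert add_mem h1 h2 using 1; ring
  · convert sub_mem h1 h2 using 1; ring

/-- The off-diagonal entries themselves need not lie in `ℚ(i)`, but their products between two
group elements do: compare the corner entries of `g h` and `g ι h`. -/
theorem four_mul_offdiag_mem (hρ : GaussianRep ρ ι z) (g h : G) :
    4 * (ρ g 0 1 * ρ h 1 0) ∈ gaussInt := by
  have h1 := (hρ.two_mul_diag_mem (g * h)).1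
  have h2 := (hρ.two_mul_diag_mem (g * (ι * h))).1
  rw [mul_apply] at h1 h2
  rw [(hρ.iota_mul_apply h 0).1, (hρ.iota_mul_apply h 0).2] at h2
  convert sub_mem h1 h2 using 1
  ring

end GaussianRep
end GHol

namespace GHol
namespace GaussianRep

open Complex
open scoped ComplexConjugate

variable {G : Type*} [Group G] {ρ : G →* Matrix (Fin 2) (Fin 2) ℂ} {ι z : G}

theorem normSq_eq_one_of_pow {s : ℂ} (hs : s ^ 4 = 1) : normSq s = 1 := by
  rcases pow_four_eq_one hs with rfl | rfl | rfl | rfl <;> simp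

/-- If the entries of `g` are those of `M` multiplied by fourth roots of unity, unitarity ties these
factors together: they come from multiplying `M` by diagonal matrices on both sides. -/
theorem entry_ratio_relations (hρ : GaussianRep ρ ι z) {g M : G} {s s' u u' : ℂ}
    (h00 : ρ g 0 0 = s * ρ M 0 0) (h01 : ρ g 0 1 = u * ρ M 0 1)
    (h10 : ρ g 1 0 = u' * ρ M 1 0) (h11 : ρ g 1 1 = s' * ρ M 1 1)
    (hs : s ^ 4 = 1) (hu : u ^ 4 = 1) (ha : ρ M 0 0 ≠ 0) (hb : ρ M 0 1 ≠ 0) :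
    s * s' = u * u' ∧ (ρ g).det = s * s' * (ρ M).det := by
  obtain ⟨hd, hc⟩ := hρ.conj_relations M
  obtain ⟨hw, hz⟩ := hρ.conj_relations g
  have hD : (ρ M).det ≠ 0 := by
    intro h
    have := (hρ.normSq_relations M).2.2.2
    simp [h] at this
  have ca : conj (ρ M 0 0) ≠ 0 := by simpa using ha
  have cb : conj (ρ M 0 1) ≠ 0 := by simpa using hb
  have ss : s * conj s = 1 := by rw [mul_conj, normSq_eq_one_of_pow hs]; simp
  have uu : u * conj u = 1 := by rw [mul_conj, normSq_eq_one_of_pow hu]; simp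
  rw [h11, hd, h00, map_mul] at hw
  rw [h10, hc, h01, map_mul] at hz
  have e1 : s * s' * (ρ M).det = (ρ g).det := by
    apply mul_right_cancel₀ ca
    linear_combination s * hw + (ρ g).det * conj (ρ M 0 0) * ss
  have e2 : u * u' * (ρ M).det = (ρ g).det := by
    apply mul_right_cancel₀ cb
    linear_combination -u * hz + (ρ g).det * conj (ρ M 0 1) * uu
  exact ⟨mul_right_cancel₀ hD (e1.trans e2.symm), e1.symm⟩

theorem map_iota_pow (hρ : GaussianRep ρ ι z) {p : ℂ} (hp : p ^ 2 = 1) :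
    ∃ e : ℕ, e ≤ 1 ∧ ρ (ι ^ e) = !![1, 0; 0, p] ∧ ρ (ι ^ (1 - e)) * ρ ι = !![1, 0; 0, p] := by
  rcases sq_eq_one_iff.1 hp with rfl | rfl
  · exact ⟨0, by simp, by simp [Matrix.one_fin_two], by simp [hρ.map_iota]⟩
  · exact ⟨1, by simp, by simp [hρ.map_iota], by simp [hρ.map_iota]⟩

theorem exists_eq_mul_of_pow_four {x w : ℂ} (hx : x ≠ 0) (h : x ^ 4 = w ^ 4)
    (hne : x ^ 2 ≠ -w ^ 2) : ∃ p : ℂ, p ^ 2 = 1 ∧ w = x * p := by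
  have : (x ^ 2 - w ^ 2) * (x ^ 2 + w ^ 2) = 0 := by linear_combination h
  rcases mul_eq_zero.1 this with h | h
  · refine ⟨w / x, ?_, by field_simp⟩
    rw [div_pow, div_eq_one_iff_eq (pow_ne_zero 2 hx), ← sub_eq_zero.1 h]
  · exact (hne (eq_neg_of_add_eq_zero_left h)).elim

theorem mem_gaussInt_of_pow {s : ℂ} (hs : s ^ 4 = 1) : s ∈ gaussInt := by
  rcases pow_four_eq_one hs with rfl | rfl | rfl | rfl
  · exact one_mem _
  · exact neg_mem (one_mem _)
  · exact mem_gaussInt.2 ⟨0, 1, by simp⟩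
  · exact mem_gaussInt.2 ⟨0, -1, by simp⟩

/-! ### Groups containing an element of square `-1` -/

section Involution

variable {M : G}

/-- An element of square `-1` has determinant `1`, hence purely imaginary half-integral diagonal
entries `a` and `-a`; the only possibility strictly between `0` and `1` in absolute value is
`±i/2`. -/
theorem diag_of_sq_eq_neg [Finite G] (hρ : GaussianRep ρ ι z) (ha : ρ M 0 0 ≠ 0)
    (hb : ρ M 0 1 ≠ 0) (hM : M ^ 2 = z) :
    ρ M 1 1 = -ρ M 0 0 ∧ (2 * ρ M 0 0) ^ 2 = -1 ∧ 4 * (ρ M 0 1 * ρ M 1 0) = -3 ∧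
      normSq (ρ M 0 0) = 1 / 4 := by
  have hz : ρ (M * M) = -1 := by rw [← sq, hM, hρ.map_neg]
  have e00 := mul_apply (ρ := ρ) M M 0 0
  have e01 := mul_apply (ρ := ρ) M M 0 1
  rw [hz] at e00 e01
  simp at e00 e01
  have hd : ρ M 1 1 = -ρ M 0 0 := by
    apply mul_left_cancel₀ hb
    linear_combination -e01
  have hD : (ρ M).det = 1 := by
    rw [Matrix.det_fin_two, hd]
    linear_combination e00
  obtain ⟨hc, -⟩ := hρ.conj_relations M
  rw [hD, hd, one_mul] at hc
  obtain ⟨m, n, hmn, hN⟩ := exists_normSq_eq (hρ.two_mul_diag_mem M).1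
  have hre : (ρ M 0 0).re = 0 := by
    have := congrArg Complex.re hc
    simp at this
    linarith
  have hm : m = 0 := by
    have := congrArg Complex.re hmn
    simp [hre] at this
    exact_mod_cast this.symm
  subst hm
  obtain ⟨hy, -⟩ := hρ.normSq_relations M
  have hypos := normSq_pos.2 hb
  have hxpos := normSq_pos.2 ha
  rw [map_mul, show normSq (2 : ℂ) = 4 by norm_num [normSq_apply]] at hN
  have hn : n ^ 2 = 1 := by
    have h1 : ((0 ^ 2 + n ^ 2 : ℤ) : ℝ) < ((4 : ℤ) : ℝ) := by
      rw [← hN]; push_cast; linarith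
    have h2 : ((0 : ℤ) : ℝ) < ((0 ^ 2 + n ^ 2 : ℤ) : ℝ) := by
      rw [← hN]; push_cast; linarith
    have h1' : 0 ^ 2 + n ^ 2 < 4 := by exact_mod_cast h1
    have h2' : 0 < 0 ^ 2 + n ^ 2 := by exact_mod_cast h2
    have : n < 2 := by nlinarith
    have : -2 < n := by nlinarith
    interval_cases n <;> simp_all
  have hsq : (2 * ρ M 0 0) ^ 2 = -1 := by
    have hn' : (n : ℂ) ^ 2 = 1 := by exact_mod_cast hn
    rw [hmn]
    push_cast
    linear_combination (n : ℂ) ^ 2 * I_sq - hn'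
  refine ⟨hd, hsq, by linear_combination -4 * e00 - hsq, ?_⟩
  have hn' : ((0 ^ 2 + n ^ 2 : ℤ) : ℝ) = 1 := by rw [hn]; norm_num
  linarith

/-- Every element is diagonal, or agrees with `M` up to units of `ℤ[i]`. With `k` four times the
squared norm of a corner entry, integrality of products of off-diagonal entries makes `12 - 3 k` a
sum of two squares, which leaves `k = 4` and `k = 1`; the units are then pinned down by integrality
of traces and of corner entries. -/
theorem form_of_sq_eq_neg [Finite G] (hρ : GaussianRep ρ ι z) (ha : ρ M 0 0 ≠ 0)
    (hb : ρ M 0 1 ≠ 0) (hM : M ^ 2 = z) (g : G) :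
    (∃ s p : ℂ, s ^ 4 = 1 ∧ p ^ 2 = 1 ∧ ρ g = !![s, 0; 0, s * p]) ∨
    (∃ s p q : ℂ, s ^ 4 = 1 ∧ p ^ 2 = 1 ∧ q ^ 2 = 1 ∧
      ρ g = !![s * ρ M 0 0, s * q * ρ M 0 1; s * p * ρ M 1 0, s * p * q * ρ M 1 1]) := by
  obtain ⟨hd, ha2, hbc, hNa⟩ := hρ.diag_of_sq_eq_neg ha hb hM
  obtain ⟨hNb, hNc, -, -⟩ := hρ.normSq_relations M
  obtain ⟨hNy, hNz, hNw, -⟩ := hρ.normSq_relations g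
  have hc : ρ M 1 0 ≠ 0 := by
    rw [← normSq_pos, hNc, hNa]; norm_num
  have n2 : normSq (2 : ℂ) = 4 := by norm_num [normSq_apply]
  have n4 : normSq (4 : ℂ) = 16 := by norm_num [normSq_apply]
  obtain ⟨m, n, -, h2x⟩ := exists_normSq_eq (hρ.two_mul_diag_mem g).1
  obtain ⟨m', n', -, h4⟩ := exists_normSq_eq (hρ.four_mul_offdiag_mem g M)
  rw [map_mul, n2] at h2x
  rw [map_mul, map_mul, n4, hNy, hNc, hNa] at h4
  have hrel : m' ^ 2 + n' ^ 2 = 12 - 3 * (m ^ 2 + n ^ 2) := by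
    have : ((m' ^ 2 + n' ^ 2 : ℤ) : ℝ) = ((12 - 3 * (m ^ 2 + n ^ 2) : ℤ) : ℝ) := by
      rw [← h4]; push_cast at h2x ⊢; linarith
    exact_mod_cast this
  -- `12 - 3 k` is a sum of two squares only for `k = 1` and `k = 4`
  have hk : m ^ 2 + n ^ 2 = 1 ∨ m ^ 2 + n ^ 2 = 4 := by
    have h0 : 0 ≤ m ^ 2 + n ^ 2 := by positivity
    have h4 : m ^ 2 + n ^ 2 ≤ 4 := by nlinarith [sq_nonneg m', sq_nonneg n']
    have hne := @sq_add_sq_ne m n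
    have hne' := @sq_add_sq_ne m' n'
    omega
  rcases hk with hk | hk
  · right
    rw [hk] at h2x hrel
    have hNx : normSq (ρ g 0 0) = 1 / 4 := by push_cast at h2x; linarith
    have p4 := fun k l ↦ pow_four_of_normSq (hρ.four_mul_offdiag_mem k l)
    have hx4 := (pow_four_of_normSq (hρ.two_mul_diag_mem g).1).1 (by
      rw [map_mul, n2, hNx]; norm_num)
    have hw4 := (pow_four_of_normSq (hρ.two_mul_diag_mem g).2).1 (by
      rw [map_mul, n2, hNw, hNx]; norm_num)
    have hy4 := (p4 g M).2.2.2 (by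
      rw [map_mul, map_mul, n4, hNy, hNc, hNx, hNa]; norm_num)
    have hz4 := (p4 M g).2.2.2 (by
      rw [map_mul, map_mul, n4, hNz, hNb, hNx, hNa]; norm_num)
    have hx0 : ρ g 0 0 ≠ 0 := by rw [← normSq_pos, hNx]; norm_num
    obtain ⟨e, he, hwe⟩ := exists_eq_mul_of_pow_four hx0 (w := ρ g 1 1)
      (by linear_combination (hx4 - hw4) / 16) (by
      intro h
      refine four_mul_normSq_ne_one (pow_mem (hρ.trace_mem g) 2) ?_
      have : (ρ g 0 0 + ρ g 1 1) ^ 2 = 2 * (ρ g 0 0 * ρ g 1 1) := by linear_combination h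
      rw [this, map_mul, map_mul, n2, hNw, hNx]; norm_num)
    obtain ⟨s, hs⟩ : ∃ s, s = ρ g 0 0 / ρ M 0 0 := ⟨_, rfl⟩
    obtain ⟨u, hu⟩ : ∃ u, u = ρ g 0 1 / ρ M 0 1 := ⟨_, rfl⟩
    obtain ⟨u', hu'⟩ : ∃ u', u' = ρ g 1 0 / ρ M 1 0 := ⟨_, rfl⟩
    rw [eq_div_iff (by assumption)] at hs hu hu'
    have hbc4 : (4 * (ρ M 0 1 * ρ M 1 0)) ^ 4 = 81 := by rw [hbc]; norm_num
    have ha4 : (2 * ρ M 0 0) ^ 4 = 1 := by linear_combination ((2 * ρ M 0 0) ^ 2 - 1) * ha2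
    have s4 : s ^ 4 = 1 := by
      rw [← hs] at hx4
      linear_combination hx4 - s ^ 4 * ha4
    have u4 : u ^ 4 = 1 := by
      rw [← hu] at hy4
      linear_combination (hy4 - u ^ 4 * hbc4) / 81
    have hw : ρ g 1 1 = -(e * s) * ρ M 1 1 := by rw [hwe, ← hs, hd]; ring
    obtain ⟨hss, -⟩ := hρ.entry_ratio_relations hs.symm hu.symm hu'.symm hw s4 u4 ha hb
    have hs0 : s ≠ 0 := by rintro rfl; simp at s4
    -- the corner entry of `g M` is half-integral, which excludes `u = ± i s`
    obtain ⟨q, hq, rfl⟩ := exists_eq_mul_of_pow_four hs0 (s4.trans u4.symm) (by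
      intro h
      have hmem := (hρ.two_mul_diag_mem (g * M)).1
      rw [mul_apply, ← hs, ← hu] at hmem
      have h' : 2 * (s * ρ M 0 0 * ρ M 0 0 + u * ρ M 0 1 * ρ M 1 0) + u = -((s + u) / 2) := by
        linear_combination s / 2 * ha2 + u / 2 * hbc
      have hmem' := add_mem hmem (mem_gaussInt_of_pow u4)
      rw [h'] at hmem'
      refine four_mul_normSq_ne_one (pow_mem hmem' 2) ?_
      have : (-((s + u) / 2)) ^ 2 = 1 / 2 * (s * u) := by linear_combination h / 4
      rw [this, map_mul, map_mul, normSq_eq_one_of_pow s4, normSq_eq_one_of_pow u4]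
      norm_num [normSq_apply])
    have hq0 : q ≠ 0 := by rintro rfl; simp at hq
    have hu'' : u' = s * (-e * q) := by
      apply mul_left_cancel₀ (mul_ne_zero hs0 hq0)
      linear_combination -hss + s ^ 2 * e * hq
    refine ⟨s, -e * q, q, s4, by rw [mul_pow, neg_sq, he, hq, one_mul], hq, ?_⟩
    rw [hs, hu, show s * (-e * q) * q = -(e * s) by linear_combination -s * e * hq, ← hw,
      ← hu'', hu']
    exact Matrix.eta_fin_two _
  · left
    rw [hk] at h2x hrel
    have hNx : normSq (ρ g 0 0) = 1 := by push_cast at h2x; linarith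
    have hy : ρ g 0 1 = 0 := by rw [← normSq_eq_zero, hNy, hNx]; norm_num
    have hz : ρ g 1 0 = 0 := by rw [← normSq_eq_zero, hNz, hNx]; norm_num
    have hx4 := (pow_four_of_normSq (hρ.two_mul_diag_mem g).1).2.2.1 (by
      rw [map_mul, n2, hNx]; norm_num)
    have hw4 := (pow_four_of_normSq (hρ.two_mul_diag_mem g).2).2.2.1 (by
      rw [map_mul, n2, hNw, hNx]; norm_num)
    have hx0 : ρ g 0 0 ≠ 0 := by rw [← normSq_pos, hNx]; norm_num
    obtain ⟨p, hp, hwp⟩ := exists_eq_mul_of_pow_four hx0 (w := ρ g 1 1)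
      (by linear_combination (hx4 - hw4) / 16) (by
      intro h
      refine four_mul_normSq_ne_one (pow_mem (hρ.trace_mem (g * M)) 2) ?_
      have : (ρ (g * M) 0 0 + ρ (g * M) 1 1) ^ 2 = 1 / 2 * (ρ g 0 0 * ρ g 1 1) := by
        rw [mul_apply, mul_apply, hy, hz, hd]
        linear_combination (ρ g 0 0 - ρ g 1 1) ^ 2 / 4 * ha2 - h / 4
      rw [this, map_mul, map_mul, hNw, hNx]
      norm_num [normSq_apply])
    refine ⟨ρ g 0 0, p, by linear_combination hx4 / 16, hp, ?_⟩
    rw [← hwp]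
    conv_lhs => rw [Matrix.eta_fin_two (ρ g), hy, hz]

/-- The cube of `ι M` is a scalar `±i`, so together with `ι` and `z` it produces all the diagonal
factors that relate an arbitrary element to `1` or to `M`. Six powers of `ι M` suffice because
`(ι M) ^ 6` is `-1`. -/
theorem exists_eq_of_sq_eq_neg [Finite G] (hρ : GaussianRep ρ ι z) (ha : ρ M 0 0 ≠ 0)
    (hb : ρ M 0 1 ≠ 0) (hM : M ^ 2 = z) (g : G) :
    ∃ ε₁ α ε₂ : ℕ, ε₁ ≤ 1 ∧ α ≤ 5 ∧ ε₂ ≤ 1 ∧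
      (g = ι ^ ε₁ * (ι * M) ^ α * ι ^ ε₂ ∨ g = z * (ι ^ ε₁ * (ι * M) ^ α * ι ^ ε₂)) := by
  obtain ⟨hd, ha2, hbc, -⟩ := hρ.diag_of_sq_eq_neg ha hb hM
  set t := 2 * ρ M 0 0 with ht
  have hcube : ρ ((ι * M) ^ 3) = t • 1 := by
    have : ρ (ι * M) = !![ρ M 0 0, ρ M 0 1; -ρ M 1 0, ρ M 0 0] := by
      rw [Matrix.eta_fin_two (ρ (ι * M)), (hρ.iota_mul_apply M 0).1, (hρ.iota_mul_apply M 0).2,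
        (hρ.iota_mul_apply M 1).1, (hρ.iota_mul_apply M 1).2, hd, neg_neg]
    rw [map_pow, this, pow_succ, pow_two]
    ext i j
    fin_cases i <;> fin_cases j <;> simp [Matrix.mul_apply, Fin.sum_univ_two]
    · linear_combination ρ M 0 0 / 4 * ha2 - 3 * ρ M 0 0 / 4 * hbc
    · linear_combination 3 * ρ M 0 1 / 4 * ha2 - ρ M 0 1 / 4 * hbc
    · linear_combination -3 * ρ M 1 0 / 4 * ha2 + ρ M 1 0 / 4 * hbc
    · linear_combination ρ M 0 0 / 4 * ha2 - 3 * ρ M 0 0 / 4 * hbc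
  have hunit : ∀ s : ℂ, s ^ 4 = 1 → ∃ j ≤ 1, s = t ^ j ∨ s = -t ^ j := by
    intro s hs
    obtain ⟨k, rfl⟩ := exists_eq_pow ha2 hs
    obtain ⟨l, rfl | rfl⟩ := Nat.even_or_odd' k
    · refine ⟨0, by simp, ?_⟩
      rw [pow_mul, ha2, pow_zero]
      exact neg_one_pow_eq_or ℂ l
    · refine ⟨1, by simp, ?_⟩
      rw [pow_succ, pow_mul, ha2, pow_one]
      rcases neg_one_pow_eq_or ℂ l with h | h <;> simp [h]
  have finish : ∀ (s : ℂ) (α : ℕ) (A : Matrix (Fin 2) (Fin 2) ℂ) (ε₁ ε₂ : ℕ), s ^ 4 = 1 →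
      ε₁ ≤ 1 → ε₂ ≤ 1 → α ≤ 2 → ρ (ι ^ ε₁) * ρ ((ι * M) ^ α) * ρ (ι ^ ε₂) = A → ρ g = s • A →
      ∃ ε₁ α ε₂ : ℕ, ε₁ ≤ 1 ∧ α ≤ 5 ∧ ε₂ ≤ 1 ∧
      (g = ι ^ ε₁ * (ι * M) ^ α * ι ^ ε₂ ∨ g = z * (ι ^ ε₁ * (ι * M) ^ α * ι ^ ε₂)) := by
    rintro s α A ε₁ ε₂ hs h1 h2 hα rfl hg
    obtain ⟨j, hj, hs⟩ := hunit s hs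
    refine ⟨ε₁, 3 * j + α, ε₂, h1, by omega, h2, ?_⟩
    have key : ρ (ι ^ ε₁ * (ι * M) ^ (3 * j + α) * ι ^ ε₂) =
        t ^ j • (ρ (ι ^ ε₁) * ρ ((ι * M) ^ α) * ρ (ι ^ ε₂)) := by
      rw [pow_add, pow_mul, map_mul, map_mul, map_mul, map_pow ρ _ j, hcube, _root_.smul_pow,
        one_pow, smul_one_mul, mul_smul_comm, smul_mul_assoc]
    refine hs.imp (fun hs ↦ hρ.injective ?_) (fun hs ↦ hρ.injective ?_)
    · rw [key, hg, hs]
    · rw [map_mul, hρ.map_neg, key, hg, hs, neg_one_mul, neg_smul]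
  rcases hρ.form_of_sq_eq_neg ha hb hM g with ⟨s, p, hs, hp, hg⟩ | ⟨s, p, q, hs, hp, hq, hg⟩
  · obtain ⟨e, he, hp, -⟩ := hρ.map_iota_pow hp
    refine finish s 0 _ 0 e hs (by simp) he (by simp) rfl ?_
    rw [hg]
    simp [hp]
  · obtain ⟨e, he, -, hp⟩ := hρ.map_iota_pow hp
    obtain ⟨f, hf, hq, -⟩ := hρ.map_iota_pow hq
    refine finish s 1 _ (1 - e) f hs (by omega) hf (by simp) rfl ?_
    rw [hg, pow_one, map_mul ρ ι M, ← mul_assoc, hp, hq, Matrix.eta_fin_two (ρ M)]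
    simp [mul_assoc, mul_comm q]

end Involution

/-! ### Groups containing elements with a cubic and a quartic relation -/

section Octahedral

variable {M N : G}

/-- If the cubic `(x ^ 2 + 1) (x + ε)`, but not `x ^ 2 + 1`, kills `M`, then by Cayley–Hamilton the
trace `t` and determinant `D` satisfy `t ^ 2 = 2 D` and `D ^ 2 = -1`. As `|t| ^ 2 = 2` and the
half-integral diagonal entries have equal norm less than `1`, they must both be `t / 2`. -/
theorem diag_of_cubic [Finite G] (hρ : GaussianRep ρ ι z) (hb : ρ M 0 1 ≠ 0)
    {ε : ℂ} (hε : ε ^ 2 = 1) (hM : ρ M ^ 3 + ε • ρ M ^ 2 + ρ M + ε • 1 = 0) (hMz : M ^ 2 ≠ z) :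
    ρ M 1 1 = ρ M 0 0 ∧ (2 * ρ M 0 0 ^ 2) ^ 2 = -1 ∧ ρ M 0 1 * ρ M 1 0 = -ρ M 0 0 ^ 2 ∧
      normSq (ρ M 0 0) = 1 / 2 := by
  obtain ⟨a, ha⟩ : ∃ a, a = ρ M 0 0 := ⟨_, rfl⟩
  obtain ⟨b, hb'⟩ : ∃ b, b = ρ M 0 1 := ⟨_, rfl⟩
  obtain ⟨c, hc⟩ : ∃ c, c = ρ M 1 0 := ⟨_, rfl⟩
  obtain ⟨d, hd⟩ : ∃ d, d = ρ M 1 1 := ⟨_, rfl⟩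
  have hmat : ρ M = !![a, b; c, d] := by rw [ha, hb', hc, hd]; exact Matrix.eta_fin_two _
  obtain ⟨hNb, -, hNd, hND⟩ := hρ.normSq_relations M
  have hbpos := normSq_pos.2 hb
  have htr := hρ.trace_iota_mul_mem M
  have h2a := (hρ.two_mul_diag_mem M).1
  rw [Matrix.det_fin_two] at hND
  rw [← ha, ← hb', ← hc, ← hd] at hND
  rw [← ha, ← hd] at htr hNd
  rw [← ha, ← hb'] at hNb
  rw [← hb'] at hb hbpos
  rw [← ha] at h2a
  have e00 := congrFun (congrFun hM 0) 0
  have e01 := congrFun (congrFun hM 0) 1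
  rw [hmat] at e00 e01
  simp [pow_succ] at e00 e01
  obtain ⟨t, ht⟩ : ∃ t, t = a + d := ⟨_, rfl⟩
  obtain ⟨D, hD⟩ : ∃ D, D = a * d - b * c := ⟨_, rfl⟩
  have e1 : t ^ 2 - D + ε * t + 1 = 0 := by
    apply mul_left_cancel₀ hb
    rw [ht, hD]
    linear_combination e01
  have e2 : -t * D - ε * D + ε = 0 := by
    rw [ht, hD] at e1 ⊢
    linear_combination e00 - a * e1
  have ht0 : t ≠ 0 := by
    intro h0
    apply hMz
    apply hρ.injective
    have hD1 : D = 1 := by rw [h0] at e1; linear_combination -e1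
    have hda : d = -a := by linear_combination h0 - ht
    rw [map_pow, hρ.map_neg, hmat, hda, sq]
    rw [hda] at hD
    ext i j
    fin_cases i <;> fin_cases j <;> simp [Matrix.mul_apply, Fin.sum_univ_two]
    · linear_combination -hD1 + hD
    · ring
    · ring
    · linear_combination -hD1 + hD
  have e3 : t ^ 2 + 2 * ε * t + 2 = 0 := by
    apply mul_left_cancel₀ ht0
    linear_combination -e2 + (t + ε) * e1 - t * hε
  have e4 : t ^ 2 = 2 * D := by linear_combination 2 * e1 - e3
  have e5 : D ^ 2 = -1 := by
    have : D = -ε * t - 1 := by linear_combination e3 - e1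
    rw [this]
    linear_combination e3 + t ^ 2 * hε
  have hNt : normSq t = 2 := by
    have h := congrArg normSq e4
    rw [map_pow, map_mul, hD, hND, show normSq (2 : ℂ) = 4 by norm_num [normSq_apply]] at h
    nlinarith [normSq_nonneg t]
  obtain ⟨m, n, -, h1⟩ := exists_normSq_eq h2a
  obtain ⟨m', n', -, h2⟩ := exists_normSq_eq htr
  rw [map_mul, show normSq (2 : ℂ) = 4 by norm_num [normSq_apply]] at h1
  have hpar : normSq t + normSq (a - d) = 4 * normSq a := by
    rw [ht, normSq_add, normSq_sub, hNd]; ring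
  rw [hNt, h2, h1] at hpar
  have hpar' : 2 + (m' ^ 2 + n' ^ 2) = m ^ 2 + n ^ 2 := by exact_mod_cast hpar
  have hlt : m ^ 2 + n ^ 2 < 4 := by
    have : ((m ^ 2 + n ^ 2 : ℤ) : ℝ) < ((4 : ℤ) : ℝ) := by
      rw [← h1]; push_cast; linarith
    exact_mod_cast this
  have h0 : m' ^ 2 + n' ^ 2 = 0 := by
    have := @sq_add_sq_ne m n
    have : 0 ≤ m' ^ 2 + n' ^ 2 := by positivity
    omega
  have hda : d = a := by
    rw [h0, Int.cast_zero, normSq_eq_zero] at h2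
    exact (sub_eq_zero.1 h2).symm
  rw [h0] at hpar'
  rw [hda] at ht hD
  have hDa : D = 2 * a ^ 2 := by linear_combination -e4 / 2 + (t + 2 * a) / 2 * ht
  refine ⟨hd ▸ ha ▸ hda, ?_, ?_, ?_⟩
  · rw [← ha, ← hDa, e5]
  · rw [← ha, ← hb', ← hc]; linear_combination hD - hDa
  · rw [← ha]
    have : ((m ^ 2 + n ^ 2 : ℤ) : ℝ) = 2 := by rw [← hpar']; norm_num
    linarith

/-- An element `N` for which `N` has order `12` and `ι N` has order `3` or `6` has determinant `-1`,
and its cube is a scalar `±i`. -/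
theorem cube_of_quartic (hρ : GaussianRep ρ ι z) (hb : ρ N 0 1 ≠ 0) {ε : ℂ}
    (hε : ε ^ 2 = 1) (hN : ρ N ^ 4 - ρ N ^ 2 + 1 = 0)
    (hιN : ρ (ι * N) ^ 2 + ε • ρ (ι * N) + 1 = 0) :
    (ρ N).det = -1 ∧ normSq (ρ N 0 0) = 1 / 2 ∧ ∃ t : ℂ, t ^ 2 = -1 ∧ ρ (N ^ 3) = t • 1 := by
  have hι : ρ (ι * N) = !![ρ N 0 0, ρ N 0 1; -ρ N 1 0, -ρ N 1 1] := by
    rw [Matrix.eta_fin_two (ρ (ι * N)), (hρ.iota_mul_apply N 0).1, (hρ.iota_mul_apply N 0).2,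
      (hρ.iota_mul_apply N 1).1, (hρ.iota_mul_apply N 1).2]
  rw [hι] at hιN
  rw [map_pow]
  generalize hA : ρ N = A at *
  obtain ⟨a, b, c, d, rfl⟩ : ∃ a b c d, A = !![a, b; c, d] :=
    ⟨_, _, _, _, Matrix.eta_fin_two A⟩
  have f00 := congrFun (congrFun hιN 0) 0
  have f01 := congrFun (congrFun hιN 0) 1
  have e00 := congrFun (congrFun hN 0) 0
  have e01 := congrFun (congrFun hN 0) 1
  simp [pow_succ] at f00 f01 e00 e01 hb
  obtain ⟨t, ht⟩ : ∃ t, t = a + d := ⟨_, rfl⟩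
  have h1 : a - d = -ε := by
    apply mul_left_cancel₀ hb
    linear_combination f01
  have hD : a * d - b * c = -1 := by linear_combination f00 - a * h1
  have ht3 : t ^ 3 + t = 0 := by
    apply mul_left_cancel₀ hb
    rw [ht]
    linear_combination e01 + b * (2 * a + 2 * d) * hD
  have ht2 : t ^ 2 = -1 := by
    rw [ht] at ht3 ⊢
    linear_combination e00 - a * ht3 -
      (-2 * (a + d) * a - (a + d) ^ 2 - 1 + (a * d - b * c + 1)) * hD
  refine ⟨by rw [Matrix.det_fin_two_of, hD], ?_, t, ht2, ?_⟩
  · have ha : a = (t - ε) / 2 := by linear_combination (h1 - ht) / 2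
    have hε' : ε = 1 ∨ ε = -1 := sq_eq_one_iff.1 hε
    have ht' : t = I ∨ t = -I := sq_eq_sq_iff_eq_or_eq_neg.1 (ht2.trans I_sq.symm)
    simp only [Matrix.of_apply, Matrix.cons_val', Matrix.cons_val_zero, ha]
    rcases hε' with rfl | rfl <;> rcases ht' with h | h <;> rw [h] <;>
      norm_num [normSq_apply]
  · rw [pow_succ, pow_two]
    ext i j
    rw [ht] at ht2 ⊢
    fin_cases i <;> fin_cases j <;> simp
    · linear_combination a * ht2 - (a + (a + d)) * hD
    · linear_combination b * ht2 - b * hD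
    · linear_combination c * ht2 - c * hD
    · linear_combination d * ht2 - (d + (a + d)) * hD

/-- Let `M` be as in `diag_of_cubic`. The corner entry of any element has norm `0`, `1 / 2` or `1`,
and in the second case the element agrees with `M` up to units of `ℤ[i]`. -/
theorem form_of_diag [Finite G] (hρ : GaussianRep ρ ι z) (hd : ρ M 1 1 = ρ M 0 0)
    (ha2 : (2 * ρ M 0 0 ^ 2) ^ 2 = -1) (hbc : ρ M 0 1 * ρ M 1 0 = -ρ M 0 0 ^ 2)
    (hNa : normSq (ρ M 0 0) = 1 / 2) (g : G) :
    ρ g 0 0 = 0 ∨ normSq (ρ g 0 0) = 1 ∨ normSq (ρ g 0 0) = 1 / 2 ∧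
      ∃ s p q : ℂ, s ^ 4 = 1 ∧ p ^ 4 = 1 ∧ q ^ 4 = 1 ∧
        (ρ g).det = s ^ 2 * (p * q) * (ρ M).det ∧
        ρ g = s • (!![1, 0; 0, p] * ρ M * !![1, 0; 0, q]) := by
  obtain ⟨hNb, hNc, -, -⟩ := hρ.normSq_relations M
  obtain ⟨hNy, hNz, hNw, -⟩ := hρ.normSq_relations g
  have ha : ρ M 0 0 ≠ 0 := by rw [← normSq_pos, hNa]; norm_num
  have hb : ρ M 0 1 ≠ 0 := by rw [← normSq_pos, hNb, hNa]; norm_num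
  have hc : ρ M 1 0 ≠ 0 := by rw [← normSq_pos, hNc, hNa]; norm_num
  have n2 : normSq (2 : ℂ) = 4 := by norm_num [normSq_apply]
  have n4 : normSq (4 : ℂ) = 16 := by norm_num [normSq_apply]
  obtain ⟨m, n, -, h2x⟩ := exists_normSq_eq (hρ.two_mul_diag_mem g).1
  obtain ⟨m', n', -, h4⟩ := exists_normSq_eq (hρ.four_mul_offdiag_mem g M)
  rw [map_mul, n2] at h2x
  rw [map_mul, map_mul, n4, hNy, hNc, hNa] at h4
  have hrel : m' ^ 2 + n' ^ 2 = 8 - 2 * (m ^ 2 + n ^ 2) := by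
    have : ((m' ^ 2 + n' ^ 2 : ℤ) : ℝ) = ((8 - 2 * (m ^ 2 + n ^ 2) : ℤ) : ℝ) := by
      rw [← h4]; push_cast at h2x ⊢; linarith
    exact_mod_cast this
  -- `k` and `8 - 2 k` are both sums of two squares only for `k = 0, 2, 4`
  have hk : m ^ 2 + n ^ 2 = 0 ∨ m ^ 2 + n ^ 2 = 4 ∨ m ^ 2 + n ^ 2 = 2 := by
    have h0 : 0 ≤ m ^ 2 + n ^ 2 := by positivity
    have h4 : m ^ 2 + n ^ 2 ≤ 4 := by nlinarith [sq_nonneg m', sq_nonneg n']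
    have hne := @sq_add_sq_ne m n
    have hne' := @sq_add_sq_ne m' n'
    omega
  rcases hk with hk | hk | hk <;> rw [hk] at h2x
  · left
    rw [← normSq_eq_zero]; push_cast at h2x; linarith
  · right; left
    push_cast at h2x; linarith
  right; right
  have hNx : normSq (ρ g 0 0) = 1 / 2 := by push_cast at h2x; linarith
  have p4 := fun k l ↦ pow_four_of_normSq (hρ.four_mul_offdiag_mem k l)
  have hx4 := (pow_four_of_normSq (hρ.two_mul_diag_mem g).1).2.1 (by
    rw [map_mul, n2, hNx]; norm_num)
  have hw4 := (pow_four_of_normSq (hρ.two_mul_diag_mem g).2).2.1 (by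
    rw [map_mul, n2, hNw, hNx]; norm_num)
  have hy4 := (p4 g M).2.2.1 (by
    rw [map_mul, map_mul, n4, hNy, hNc, hNx, hNa]; norm_num)
  have hz4 := (p4 M g).2.2.1 (by
    rw [map_mul, map_mul, n4, hNz, hNb, hNx, hNa]; norm_num)
  obtain ⟨s, hs⟩ : ∃ s, s = ρ g 0 0 / ρ M 0 0 := ⟨_, rfl⟩
  obtain ⟨u, hu⟩ : ∃ u, u = ρ g 0 1 / ρ M 0 1 := ⟨_, rfl⟩
  obtain ⟨u', hu'⟩ : ∃ u', u' = ρ g 1 0 / ρ M 1 0 := ⟨_, rfl⟩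
  obtain ⟨s', hs'⟩ : ∃ s', s' = ρ g 1 1 / ρ M 0 0 := ⟨_, rfl⟩
  rw [eq_div_iff (by assumption)] at hs hu hu' hs'
  have ha4 : (2 * ρ M 0 0) ^ 4 = -4 := by linear_combination 4 * ha2
  have hbc4 : (4 * (ρ M 0 1 * ρ M 1 0)) ^ 4 = 16 := by
    rw [hbc]; linear_combination 16 * ((2 * ρ M 0 0 ^ 2) ^ 2 - 1) * ha2
  have s4 : s ^ 4 = 1 := by
    rw [← hs] at hx4
    linear_combination -hx4 / 4 + s ^ 4 / 4 * ha4
  have u4 : u ^ 4 = 1 := by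
    rw [← hu] at hy4
    linear_combination (hy4 - u ^ 4 * hbc4) / 16
  have u4' : u' ^ 4 = 1 := by
    rw [← hu'] at hz4
    linear_combination (hz4 - u' ^ 4 * hbc4) / 16
  have hs0 : s ≠ 0 := by rintro rfl; simp at s4
  rw [← hd] at hs'
  obtain ⟨hss, hdet⟩ := hρ.entry_ratio_relations hs.symm hu.symm hu'.symm hs'.symm s4 u4 ha hb
  have hsu : s * (u' / s * (u / s)) = s' := by
    field_simp
    linear_combination -hss
  refine ⟨hNx, s, u' / s, u / s, s4, by rw [div_pow, u4', s4, div_one],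
    by rw [div_pow, u4, s4, div_one], ?_, ?_⟩
  · rw [hdet, ← hsu]; ring
  · rw [Matrix.eta_fin_two (ρ g), ← hs, ← hu, ← hu', ← hs', ← hsu, Matrix.eta_fin_two (ρ M)]
    ext i j
    fin_cases i <;> fin_cases j <;> simp
    · field_simp
    · field_simp
    · ring

/-- A subgroup containing `M`, `N` and `ι` contains every diagonal matrix of fourth roots of unity.
The scalars are powers of `N ^ 3`. Writing `N` as `s • diag(1, p) M diag(1, q)`, the determinants
give `(p q) ^ 2 = -1`, so one of the two diagonal factors is a power of `ι`, and the other one, of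
order `4`, can be solved for. -/
theorem exists_diagonal_mem [Finite G] (hρ : GaussianRep ρ ι z) (hd : ρ M 1 1 = ρ M 0 0)
    (ha2 : (2 * ρ M 0 0 ^ 2) ^ 2 = -1) (hbc : ρ M 0 1 * ρ M 1 0 = -ρ M 0 0 ^ 2)
    (hNa : normSq (ρ M 0 0) = 1 / 2) (hN : (ρ N).det = -1) (hNN : normSq (ρ N 0 0) = 1 / 2)
    (hcube : ∃ t : ℂ, t ^ 2 = -1 ∧ ρ (N ^ 3) = t • 1) {K : Subgroup G} (hMK : M ∈ K)
    (hNK : N ∈ K) (hιK : ι ∈ K) {u v : ℂ} (hu : u ^ 4 = 1) (hv : v ^ 4 = 1) :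
    ∃ k ∈ K, ρ k = !![u, 0; 0, v] := by
  obtain ⟨t, ht, hcube⟩ := hcube
  have scalar : ∀ s : ℂ, s ^ 4 = 1 → ∃ k ∈ K, ρ k = s • 1 := by
    intro s hs
    obtain ⟨j, rfl⟩ := exists_eq_pow ht hs
    exact ⟨(N ^ 3) ^ j, pow_mem (pow_mem hNK 3) j, by
      rw [map_pow, hcube, _root_.smul_pow, one_pow]⟩
  have sign : ∀ p : ℂ, p ^ 2 = 1 → ∃ k ∈ K, ρ k = !![1, 0; 0, p] := by
    intro p hp
    obtain ⟨e, -, he, -⟩ := hρ.map_iota_pow hp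
    exact ⟨ι ^ e, pow_mem hιK e, he⟩
  have solve : ∃ q : ℂ, q ^ 2 = -1 ∧ ∃ k ∈ K, ρ k = !![1, 0; 0, q] := by
    rcases hρ.form_of_diag hd ha2 hbc hNa N with h | h | ⟨-, s, p, q, hs, hp, hq, hdet, hform⟩
    · rw [h] at hNN; norm_num at hNN
    · rw [h] at hNN; norm_num at hNN
    have hpq : p ^ 2 * q ^ 2 = -1 := by
      have hD : (ρ M).det ^ 2 = -1 := by
        rw [Matrix.det_fin_two, hd, hbc, ← ha2]; ring
      rw [hN] at hdet
      have := congrArg (· ^ 2) hdet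
      linear_combination this + s ^ 4 * p ^ 2 * q ^ 2 * hD - p ^ 2 * q ^ 2 * hs
    obtain ⟨σ, hσK, hσ⟩ := scalar s hs
    rcases sq_eq_one_or_neg_one hp with hp2 | hp2
    · obtain ⟨δ, hδK, hδ⟩ := sign p hp2
      refine ⟨q, by rw [hp2, one_mul] at hpq; exact hpq, (σ * δ * M)⁻¹ * N,
        mul_mem (inv_mem (mul_mem (mul_mem hσK hδK) hMK)) hNK, ?_⟩
      have : ρ N = ρ (σ * δ * M) * !![1, 0; 0, q] := by
        rw [hform, map_mul, map_mul, hσ, hδ, smul_one_mul, smul_mul_assoc, smul_mul_assoc]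
      rw [map_mul, this, ← mul_assoc, ← map_mul, inv_mul_cancel, map_one, one_mul]
    · obtain ⟨δ, hδK, hδ⟩ := sign q (by rw [hp2] at hpq; linear_combination -hpq)
      refine ⟨p, hp2, N * (σ * M * δ)⁻¹,
        mul_mem hNK (inv_mem (mul_mem (mul_mem hσK hMK) hδK)), ?_⟩
      have : ρ N = !![1, 0; 0, p] * ρ (σ * M * δ) := by
        rw [hform, map_mul, map_mul, hσ, hδ, smul_one_mul, smul_mul_assoc, mul_smul_comm,
          mul_assoc]
      rw [map_mul, this, mul_assoc, ← map_mul, mul_inv_cancel, map_one, mul_one]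
  obtain ⟨q, hq, δ, hδK, hδ⟩ := solve
  have hu0 : u ≠ 0 := by rintro rfl; simp at hu
  obtain ⟨j, hj⟩ := exists_eq_pow (u := v / u) hq (by rw [div_pow, hu, hv, div_one])
  obtain ⟨σ, hσK, hσ⟩ := scalar u hu
  refine ⟨σ * δ ^ j, mul_mem hσK (pow_mem hδK j), ?_⟩
  have hpow : ∀ j : ℕ, !![1, 0; 0, q] ^ j = !![1, 0; 0, q ^ j] := by
    intro j
    induction j with
    | zero => simp [Matrix.one_fin_two]
    | succ j ih => rw [pow_succ, ih]; simp [pow_succ]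
  rw [map_mul, map_pow, hσ, hδ, hpow, ← hj, smul_one_mul]
  simp [mul_div_cancel₀ v hu0]

/-- The subgroup of elements acting by diagonal matrices. -/
def diagonalSubgroup (hρ : GaussianRep ρ ι z) : Subgroup G where
  carrier := {g | ρ g 0 1 = 0}
  one_mem' := by simp
  mul_mem' := by
    intro g h hg hh
    simp only [Set.mem_ofPred_eq] at hg hh ⊢
    simp [mul_apply, hg, hh]
  inv_mem' := by
    intro g hg
    simp only [Set.mem_ofPred_eq] at hg ⊢
    have h : ρ g⁻¹ = (ρ g)ᴴ := by
      calc ρ g⁻¹ = (ρ g)ᴴ * ρ g * ρ g⁻¹ := by rw [hρ.unitary, one_mul]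
        _ = _ := by rw [mul_assoc, ← map_mul, mul_inv_cancel, map_one, mul_one]
    rw [h, Matrix.conjTranspose_apply, (hρ.conj_relations g).2, hg]
    simp

theorem mem_diagonalSubgroup (hρ : GaussianRep ρ ι z) {g : G} :
    g ∈ hρ.diagonalSubgroup ↔ ρ g 0 1 = 0 := Iff.rfl

theorem eq_diagonal_of_mem (hρ : GaussianRep ρ ι z) {g : G} (hg : g ∈ hρ.diagonalSubgroup) :
    ρ g = !![ρ g 0 0, 0; 0, ρ g 1 1] := by
  have h01 : ρ g 0 1 = 0 := hg
  have h10 : ρ g 1 0 = 0 := by rw [(hρ.conj_relations g).2, h01]; simp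
  conv_lhs => rw [Matrix.eta_fin_two (ρ g), h01, h10]

theorem pow_four_of_mem_diagonal [Finite G] (hρ : GaussianRep ρ ι z) {g : G}
    (hg : g ∈ hρ.diagonalSubgroup) : ρ g 0 0 ^ 4 = 1 ∧ ρ g 1 1 ^ 4 = 1 := by
  obtain ⟨h1, -, h2, -⟩ := hρ.normSq_relations g
  rw [(hρ.mem_diagonalSubgroup.1 hg), normSq_zero] at h1
  have hx : normSq (ρ g 0 0) = 1 := by linarith
  have hx4 := (pow_four_of_normSq (hρ.two_mul_diag_mem g).1).2.2.1 (by
    rw [map_mul, hx]; norm_num [normSq_apply])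
  have hw4 := (pow_four_of_normSq (hρ.two_mul_diag_mem g).2).2.2.1 (by
    rw [map_mul, h2, hx]; norm_num [normSq_apply])
  exact ⟨by linear_combination hx4 / 16, by linear_combination hw4 / 16⟩

theorem isMulCommutative_diagonalSubgroup (hρ : GaussianRep ρ ι z) :
    IsMulCommutative hρ.diagonalSubgroup := by
  refine ⟨⟨fun a b ↦ Subtype.ext (hρ.injective ?_)⟩⟩
  simp only [Subgroup.coe_mul, map_mul]
  rw [hρ.eq_diagonal_of_mem a.2, hρ.eq_diagonal_of_mem b.2]
  simp [mul_comm]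

theorem card_diagonalSubgroup [Finite G] (hρ : GaussianRep ρ ι z)
    (h : ∀ u v : ℂ, u ^ 4 = 1 → v ^ 4 = 1 → ∃ k : G, ρ k = !![u, 0; 0, v]) :
    Nat.card hρ.diagonalSubgroup = 16 := by
  let R := nthRootsFinset 4 (1 : ℂ)
  have hR : ∀ x : ℂ, x ∈ R ↔ x ^ 4 = 1 := fun x ↦ mem_nthRootsFinset (by norm_num) 1
  have hcard : Nat.card R = 4 := by
    rw [Nat.card_eq_fintype_card, Fintype.card_coe]
    exact (Complex.isPrimitiveRoot_exp 4 (by norm_num)).card_nthRootsFinset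
  let f : hρ.diagonalSubgroup → R × R := fun g ↦
    (⟨ρ g 0 0, (hR _).2 (hρ.pow_four_of_mem_diagonal g.2).1⟩,
      ⟨ρ g 1 1, (hR _).2 (hρ.pow_four_of_mem_diagonal g.2).2⟩)
  have hf : Function.Bijective f := by
    constructor
    · intro a b hab
      simp only [f, Prod.mk.injEq, Subtype.mk.injEq] at hab
      refine Subtype.ext (hρ.injective ?_)
      rw [hρ.eq_diagonal_of_mem a.2, hρ.eq_diagonal_of_mem b.2, hab.1, hab.2]
    · rintro ⟨⟨u, hu⟩, ⟨v, hv⟩⟩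
      obtain ⟨k, hk⟩ := h u v ((hR u).1 hu) ((hR v).1 hv)
      refine ⟨⟨k, by rw [mem_diagonalSubgroup, hk]; rfl⟩, ?_⟩
      simp [f, hk]
  rw [Nat.card_congr (Equiv.ofBijective f hf), Nat.card_prod, hcard]

/-- Structure of the group in the presence of `M` and `N`: the corner entry of an element has norm
`1`, `1 / 2` or `0`, and the element lies accordingly in `H`, in `H M H` or in `H M ^ 2`, where `H`
is the group of all diagonal matrices of fourth roots of unity. -/
theorem structure_of_cubic_quartic [Finite G] (hρ : GaussianRep ρ ι z) (hb : ρ M 0 1 ≠ 0) {ε : ℂ}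
    (hε : ε ^ 2 = 1) (hM : ρ M ^ 3 + ε • ρ M ^ 2 + ρ M + ε • 1 = 0) (hMz : M ^ 2 ≠ z)
    (hbN : ρ N 0 1 ≠ 0) {ε' : ℂ} (hε' : ε' ^ 2 = 1) (hN : ρ N ^ 4 - ρ N ^ 2 + 1 = 0)
    (hιN : ρ (ι * N) ^ 2 + ε' • ρ (ι * N) + 1 = 0) :
    Nat.card hρ.diagonalSubgroup = 16 ∧
      (∀ g, ∃ η₁ ∈ hρ.diagonalSubgroup, ∃ η₂ ∈ hρ.diagonalSubgroup, ∃ α : ℕ, α ≤ 2 ∧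
        g = η₁ * M ^ α * η₂) ∧
      ∀ K : Subgroup G, M ∈ K → N ∈ K → ι ∈ K → K = ⊤ := by
  obtain ⟨hd, ha2, hbc, hNa⟩ := hρ.diag_of_cubic hb hε hM hMz
  obtain ⟨hdetN, hNN, hcube⟩ := hρ.cube_of_quartic hbN hε' hN hιN
  have hdiag := fun K hMK hNK hιK u v hu hv ↦ hρ.exists_diagonal_mem hd ha2 hbc hNa hdetN hNN
    hcube (K := K) hMK hNK hιK (u := u) (v := v) hu hv
  have hform : ∀ g, ∃ η₁ ∈ hρ.diagonalSubgroup, ∃ η₂ ∈ hρ.diagonalSubgroup, ∃ α : ℕ, α ≤ 2 ∧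
      g = η₁ * M ^ α * η₂ := by
    intro g
    rcases hρ.form_of_diag hd ha2 hbc hNa g with h | h | ⟨-, s, p, q, hs, hp, hq, -, hg⟩
    · -- `M ^ 2` is antidiagonal, so `g M ^ 2` is diagonal, while `M ^ 4` is diagonal as well
      have hM2 : ρ (M ^ 2) 0 0 = 0 := by
        rw [sq, mul_apply, hbc]; ring
      have hM2' : ρ (M ^ 2) 1 1 = 0 := by
        rw [sq, mul_apply, hd, mul_comm (ρ M 1 0), hbc]; ring
      have hw : ρ g 1 1 = 0 := by rw [(hρ.conj_relations g).1, h]; simp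
      have h4 : M ^ 2 * M ^ 2 ∈ hρ.diagonalSubgroup := by
        rw [mem_diagonalSubgroup, mul_apply, hM2, hM2']; ring
      have hg : g * M ^ 2 ∈ hρ.diagonalSubgroup := by
        rw [mem_diagonalSubgroup, mul_apply, h, hM2']; ring
      exact ⟨g * M ^ 2 * (M ^ 2 * M ^ 2)⁻¹, mul_mem hg (inv_mem h4), 1, one_mem _, 2, le_rfl,
        by group⟩
    · refine ⟨g, ?_, 1, one_mem _, 0, by simp, by simp⟩
      rw [mem_diagonalSubgroup, ← normSq_eq_zero, (hρ.normSq_relations g).1, h, sub_self]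
    · obtain ⟨k, -, hk⟩ := hdiag ⊤ trivial trivial trivial s (s * p) hs
        (by rw [mul_pow, hs, hp, one_mul])
      obtain ⟨l, -, hl⟩ := hdiag ⊤ trivial trivial trivial 1 q (one_pow 4) hq
      refine ⟨k, ?_, l, ?_, 1, by simp, hρ.injective ?_⟩
      · rw [mem_diagonalSubgroup, hk]; rfl
      · rw [mem_diagonalSubgroup, hl]; rfl
      · rw [hg, map_mul, map_mul, pow_one, hk, hl, ← smul_mul_assoc, ← smul_mul_assoc]
        simp
  refine ⟨hρ.card_diagonalSubgroup fun u v hu hv ↦ ?_, hform, fun K hMK hNK hιK ↦ ?_⟩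
  · obtain ⟨k, -, hk⟩ := hdiag ⊤ trivial trivial trivial u v hu hv
    exact ⟨k, hk⟩
  · have hHK : hρ.diagonalSubgroup ≤ K := by
      intro η hη
      obtain ⟨h0, h1⟩ := hρ.pow_four_of_mem_diagonal hη
      obtain ⟨k, hkK, hk⟩ := hdiag K hMK hNK hιK _ _ h0 h1
      rwa [hρ.injective ((hρ.eq_diagonal_of_mem hη).trans hk.symm)]
    refine eq_top_iff.2 fun g _ ↦ ?_
    obtain ⟨η₁, h₁, η₂, h₂, α, -, rfl⟩ := hform g
    exact mul_mem (mul_mem (hHK h₁) (pow_mem hMK α)) (hHK h₂)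

end Octahedral
end GaussianRep

/-! ### The symplectic form preserved by Types I, II and III -/

/-- The standard alternating form on `ℚ²`. -/
def symp₂ : Matrix (Fin 2) (Fin 2) ℚ := !![0, 1; -1, 0]

/-- The orthogonal sum of two copies of the standard alternating form. -/
def symp₄ : Matrix (Fin 2 ⊕ Fin 2) (Fin 2 ⊕ Fin 2) ℚ := Matrix.fromBlocks symp₂ 0 0 symp₂

theorem transpose_mul_symp₂ (A : Matrix (Fin 2) (Fin 2) ℚ) : Aᵀ * symp₂ = symp₂ * A.adjugate := by
  rw [Matrix.adjugate_fin_two, symp₂]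
  ext i j
  fin_cases i <;> fin_cases j <;> simp [Matrix.mul_apply, Fin.sum_univ_two]

/-- The conditions on the blocks say that `M` preserves `symp₄`; the remaining off-diagonal block of
`Mᵀ * symp₄ * M` is minus the transpose of the one in the last hypothesis. -/
theorem isSymplectic_of_blocks {M : GL4} (h₁ : (A₁ M).det + (A₃ M).det = 1)
    (h₂ : (A₂ M).det + (A₄ M).det = 1)
    (h : (A₁ M).adjugate * A₂ M + (A₃ M).adjugate * A₄ M = 0) :
    M.valᵀ * symp₄ * M.val = symp₄ := by
  have hM : M.val = Matrix.fromBlocks (A₁ M) (A₂ M) (A₃ M) (A₄ M) :=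
    (Matrix.fromBlocks_toBlocks M.val).symm
  have h' : (A₂ M)ᵀ * (symp₂ * A₁ M) + (A₄ M)ᵀ * (symp₂ * A₃ M) = 0 := by
    have hs : symp₂ᵀ = -symp₂ := by
      ext i j; fin_cases i <;> fin_cases j <;> simp [symp₂]
    have := congrArg (fun B ↦ -(symp₂ * B)ᵀ) h
    simpa [mul_add, ← mul_assoc, ← transpose_mul_symp₂, Matrix.transpose_mul, hs, -neg_add_rev,
      neg_add, add_comm] using this
  rw [hM, Matrix.fromBlocks_transpose, symp₄, Matrix.fromBlocks_multiply,
    Matrix.fromBlocks_multiply]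
  simp only [mul_zero, add_zero, zero_add]
  congr 1
  · simp only [transpose_mul_symp₂, mul_assoc, Matrix.adjugate_mul, ← mul_add, ← add_smul, h₁]
    simp
  · simp only [transpose_mul_symp₂, mul_assoc, ← mul_add, h, mul_zero]
  · simpa only [mul_assoc] using h'
  · simp only [transpose_mul_symp₂, mul_assoc, Matrix.adjugate_mul, ← mul_add, ← add_smul, h₂]
    simp

theorem det_smul_inv_mul {A : Matrix (Fin 2) (Fin 2) ℚ} (hA : A.det ≠ 0)
    (B : Matrix (Fin 2) (Fin 2) ℚ) : A.det • (A⁻¹ * B) = A.adjugate * B := by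
  rw [Matrix.inv_def, smul_mul_assoc, smul_smul, Ring.mul_inverse_cancel _ hA.isUnit, one_smul]

/-- Types I, II and III are special cases of one condition, preserving `symp₄`, which unlike the
types themselves is stable under products. -/
theorem isSymplectic_of_type {M : GL4} (h : TypeI M ∨ TypeII M ∨ TypeIII M) :
    M.valᵀ * symp₄ * M.val = symp₄ := by
  rcases h with ⟨h1, h4, h2, h3⟩ | ⟨h3, h2, h1, h4⟩ | ⟨⟨n1, -, n3, -⟩, h14, h23, h13, h⟩
  · apply isSymplectic_of_blocks <;> simp [h1, h2, h3, h4]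
  · apply isSymplectic_of_blocks <;> simp [h1, h2, h3, h4]
  · apply isSymplectic_of_blocks h13 (by rw [← h14, h23, add_comm, h13])
    rw [det_smul_inv_mul n1, det_smul_inv_mul n3] at h
    rw [h, neg_add_cancel]

theorem isSymplectic_of_mem_typeGroup {v₁ v₂ : ℂ × ℂ → ℂ} {M : GL4} (hM : M ∈ typeGroup v₁ v₂) :
    M.valᵀ * symp₄ * M.val = symp₄ := by
  induction hM using Subgroup.closure_induction with
  | mem M hM => exact isSymplectic_of_type hM.2
  | one => simp
  | mul M N _ _ hM hN =>
    rw [Units.val_mul, Matrix.transpose_mul]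
    calc _ = N.valᵀ * (M.valᵀ * symp₄ * M.val) * N.val := by simp only [mul_assoc]
      _ = _ := by rw [hM, hN]
  | inv M _ hM =>
    have h1 : M.val * M⁻¹.val = 1 := M.mul_inv
    have h2 : M⁻¹.valᵀ * M.valᵀ = 1 := by rw [← Matrix.transpose_mul, h1, Matrix.transpose_one]
    calc M⁻¹.valᵀ * symp₄ * M⁻¹.val = M⁻¹.valᵀ * (M.valᵀ * symp₄ * M.val) * M⁻¹.val := by rw [hM]
      _ = (M⁻¹.valᵀ * M.valᵀ) * symp₄ * (M.val * M⁻¹.val) := by simp only [mul_assoc]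
      _ = symp₄ := by rw [h1, h2, one_mul, mul_one]

/-- A block-diagonal symplectic matrix has blocks of determinant `1`. -/
theorem typeI_of_isSymplectic {M : GL4} (h : M.valᵀ * symp₄ * M.val = symp₄) (h₂ : A₂ M = 0)
    (h₃ : A₃ M = 0) : TypeI M := by
  have hM : M.val = Matrix.fromBlocks (A₁ M) 0 0 (A₄ M) := by
    conv_lhs => rw [← Matrix.fromBlocks_toBlocks M.val]
    exact congrArg₂ (fun B C ↦ Matrix.fromBlocks (A₁ M) B C (A₄ M)) h₂ h₃
  rw [hM, Matrix.fromBlocks_transpose, symp₄, Matrix.fromBlocks_multiply,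
    Matrix.fromBlocks_multiply] at h
  simp only [Matrix.transpose_zero, mul_zero, zero_mul, add_zero, zero_add, transpose_mul_symp₂,
    mul_assoc, Matrix.adjugate_mul, Matrix.fromBlocks_inj] at h
  have key : ∀ r : ℚ, symp₂ * r • 1 = symp₂ → r = 1 := by
    intro r hr
    have := congrFun (congrFun hr 0) 1
    simpa [symp₂] using this
  exact ⟨key _ h.1, key _ h.2.2.2, h₂, h₃⟩

/-! ### Bases and coordinates for the tangent plane -/

open Complex

/-- A basis of the tangent plane `{(x, τ₁ x, y, τ₂ y)}`, written in columns and scaled so as to be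
orthonormal for the Hermitian form that `symp₄` induces after division by `2 i`. Row `inl i`,
`inr i` of the matrix is the `i`-th entry of the first, second list. -/
noncomputable def tangentBasis (τ₁ τ₂ : ℂ) : Matrix (Fin 2 ⊕ Fin 2) (Fin 2) ℂ :=
  fun i k ↦ Sum.elim ![![((√τ₁.im : ℝ) : ℂ)⁻¹, 0], ![((√τ₁.im : ℝ) : ℂ)⁻¹ * τ₁, 0]]
    ![![0, ((√τ₂.im : ℝ) : ℂ)⁻¹], ![0, ((√τ₂.im : ℝ) : ℂ)⁻¹ * τ₂]] i k

/-- The coordinates of a tangent vector in `tangentBasis`, read off from its entries `u₁`, `u₂`. -/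
noncomputable def tangentCoord (τ₁ τ₂ : ℂ) : Matrix (Fin 2) (Fin 2 ⊕ Fin 2) ℂ :=
  fun k i ↦ Sum.elim ![![((√τ₁.im : ℝ) : ℂ), 0], ![0, 0]] ![![0, ((√τ₂.im : ℝ) : ℂ)], ![0, 0]] i k

/-- A rational matrix regarded as a complex one. -/
noncomputable abbrev toC (M : GL4) : Matrix (Fin 2 ⊕ Fin 2) (Fin 2 ⊕ Fin 2) ℂ :=
  M.val.map (algebraMap ℚ ℂ)

/-- The matrix, in `tangentBasis`, of the action of `M` on the tangent plane. -/
noncomputable def tangentMap (τ₁ τ₂ : ℂ) (M : GL4) : Matrix (Fin 2) (Fin 2) ℂ :=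
  tangentCoord τ₁ τ₂ * toC M * tangentBasis τ₁ τ₂

theorem sqrt_im_ne_zero {τ : ℂ} (h : 0 < τ.im) : ((√τ.im : ℝ) : ℂ) ≠ 0 := by
  exact_mod_cast (Real.sqrt_pos.2 h).ne'

theorem tangentCoord_mul_tangentBasis {τ₁ τ₂ : ℂ} (h₁ : 0 < τ₁.im) (h₂ : 0 < τ₂.im) :
    tangentCoord τ₁ τ₂ * tangentBasis τ₁ τ₂ = 1 := by
  have := sqrt_im_ne_zero h₁
  have := sqrt_im_ne_zero h₂
  ext i j
  fin_cases i <;> fin_cases j <;>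
    simp [Matrix.mul_apply, tangentCoord, tangentBasis, *]

/-- Up to the factor `2 i`, the form `symp₄` restricts to the standard Hermitian form on the tangent
plane: `τ - conj τ = 2 i Im τ` is cancelled by the scaling. -/
theorem tangentBasis_symp {τ₁ τ₂ : ℂ} (h₁ : 0 < τ₁.im) (h₂ : 0 < τ₂.im) :
    (tangentBasis τ₁ τ₂)ᴴ * symp₄.map (algebraMap ℚ ℂ) * tangentBasis τ₁ τ₂ = (2 * I) • 1 := by
  have key : ∀ τ : ℂ, 0 < τ.im → ((√τ.im : ℝ) : ℂ)⁻¹ * (((√τ.im : ℝ) : ℂ)⁻¹ * τ) -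
      ((√τ.im : ℝ) : ℂ)⁻¹ * (starRingEnd ℂ) τ * ((√τ.im : ℝ) : ℂ)⁻¹ = 2 * I := by
    intro τ hτ
    have h0 := sqrt_im_ne_zero hτ
    have h : ((√τ.im : ℝ) : ℂ) ^ 2 = τ.im := by exact_mod_cast Real.sq_sqrt hτ.le
    have h' : τ - (starRingEnd ℂ) τ = 2 * τ.im * I := by
      rw [sub_conj]; push_cast; ring
    field_simp
    rw [h, h']; ring
  ext i j
  fin_cases i <;> fin_cases j <;>
    simp [Matrix.mul_apply, tangentBasis, symp₄, symp₂]
  · linear_combination key τ₁ h₁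
  · linear_combination key τ₂ h₂

/-- A matrix whose columns are tangent is recovered from its tangent coordinates. -/
theorem tangentBasis_mul_tangentCoord_mul {τ₁ τ₂ : ℂ} (h₁ : 0 < τ₁.im) (h₂ : 0 < τ₂.im)
    {A : Matrix (Fin 2 ⊕ Fin 2) (Fin 2) ℂ}
    (hA : ∀ k, A (Sum.inl 1) k = τ₁ * A (Sum.inl 0) k ∧ A (Sum.inr 1) k = τ₂ * A (Sum.inr 0) k) :
    tangentBasis τ₁ τ₂ * (tangentCoord τ₁ τ₂ * A) = A := by
  have := sqrt_im_ne_zero h₁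
  have := sqrt_im_ne_zero h₂
  ext i k
  rw [← Matrix.mul_assoc, Matrix.mul_apply]
  obtain ⟨e1, e2⟩ := hA k
  rcases i with i | i <;> fin_cases i <;>
    simp [Matrix.mul_apply, tangentCoord, tangentBasis, *] <;> field_simp <;> simp

/-! ### The representation of the group on the tangent plane -/

section

variable {v₁ v₂ : ℂ × ℂ → ℂ} {τ₁ τ₂ : ℂ}

/-- Differentiating along curves in `X`, an automorphism of the germ preserves the tangent plane. -/
theorem act_tangent (hX : IsGHol v₁ v₂ τ₁ τ₂) {M : GL4} (hM : M ∈ ratAut (graphSet v₁ v₂)) {w : C4}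
    (hw₁ : w (Sum.inl 1) = τ₁ * w (Sum.inl 0)) (hw₂ : w (Sum.inr 1) = τ₂ * w (Sum.inr 0)) :
    act M w (Sum.inl 1) = τ₁ * act M w (Sum.inl 0) ∧
      act M w (Sum.inr 1) = τ₂ * act M w (Sum.inr 0) := by
  have hv₁ : v₁ 0 = 0 := by
    have := hX.odd₁.self_of_nhds
    rw [neg_zero] at this
    exact self_eq_neg.1 this
  have hv₂ : v₂ 0 = 0 := by
    have := hX.odd₂.self_of_nhds
    rw [neg_zero] at this
    exact self_eq_neg.1 this
  have comp : ∀ {v : ℂ × ℂ → ℂ} {L : ℂ × ℂ →L[ℂ] ℂ} {f g : ℂ → ℂ} {f' g' : ℂ},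
      HasFDerivAt v L 0 → HasDerivAt f f' 0 → HasDerivAt g g' 0 → f 0 = 0 → g 0 = 0 →
      HasDerivAt (fun s ↦ v (f s, g s)) (L (f', g')) 0 := by
    intro v L f g f' g' hv hf hg hf0 hg0
    have h0 : ((f 0, g 0) : ℂ × ℂ) = 0 := by rw [hf0, hg0]; rfl
    rw [← h0] at hv
    exact hv.comp_hasDerivAt (0 : ℂ) (hf.prodMk hg)
  let γ : ℂ → C4 := fun s ↦ Sum.elim
    ![s * w (Sum.inl 0), v₁ (s * w (Sum.inl 0), s * w (Sum.inr 0))]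
    ![s * w (Sum.inr 0), v₂ (s * w (Sum.inl 0), s * w (Sum.inr 0))]
  have hlin : ∀ c : ℂ, HasDerivAt (fun s : ℂ ↦ s * c) c 0 := fun c ↦ by
    simpa using (hasDerivAt_id (0 : ℂ)).mul_const c
  have hγ : HasDerivAt γ w 0 := by
    rw [hasDerivAt_pi]
    rintro (i | i) <;> fin_cases i
    · exact hlin _
    · have := comp hX.linear₁ (hlin (w (Sum.inl 0))) (hlin (w (Sum.inr 0))) (by simp) (by simp)
      simpa [γ, hw₁] using this
    · exact hlin _
    · have := comp hX.linear₂ (hlin (w (Sum.inl 0))) (hlin (w (Sum.inr 0))) (by simp) (by simp)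
      simpa [γ, hw₂] using this
  have hγ0 : γ 0 = 0 := by
    have h0 : ((0, 0) : ℂ × ℂ) = 0 := rfl
    ext i
    rcases i with i | i <;> fin_cases i <;> simp [γ, h0, hv₁, hv₂]
  have hMγ : HasDerivAt (fun s ↦ act M (γ s)) (act M w) 0 :=
    (LinearMap.toContinuousLinearMap (Matrix.mulVecLin (toC M))).hasFDerivAt.comp_hasDerivAt
      (0 : ℂ) hγ
  have hMγ0 : act M (γ 0) = 0 := by rw [hγ0]; simp [act]
  have hev : ∀ᶠ s in 𝓝 (0 : ℂ), act M (γ s) ∈ graphSet v₁ v₂ := by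
    have ht : Filter.Tendsto γ (𝓝 0) (𝓝 0) := by
      have := hγ.continuousAt.tendsto
      rwa [hγ0] at this
    filter_upwards [ht.eventually hM] with s hs
    exact hs.2 ⟨rfl, rfl⟩
  have hi := hasDerivAt_pi.1 hMγ
  constructor
  · have h := comp hX.linear₁ (hi (Sum.inl 0)) (hi (Sum.inr 0)) (by rw [hMγ0]; rfl)
      (by rw [hMγ0]; rfl)
    have := (h.congr_of_eventuallyEq (hev.mono fun s hs ↦ hs.1)).unique (hi (Sum.inl 1))
    simpa using this.symm
  · have h := comp hX.linear₂ (hi (Sum.inl 0)) (hi (Sum.inr 0)) (by rw [hMγ0]; rfl)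
      (by rw [hMγ0]; rfl)
    have := (h.congr_of_eventuallyEq (hev.mono fun s hs ↦ hs.2)).unique (hi (Sum.inr 1))
    simpa using this.symm

theorem toC_mul_tangentBasis (hX : IsGHol v₁ v₂ τ₁ τ₂) {M : GL4}
    (hM : M ∈ ratAut (graphSet v₁ v₂)) :
    toC M * tangentBasis τ₁ τ₂ = tangentBasis τ₁ τ₂ * tangentMap τ₁ τ₂ M := by
  rw [tangentMap, Matrix.mul_assoc]
  refine (tangentBasis_mul_tangentCoord_mul hX.im_pos₁ hX.im_pos₂ fun k ↦ ?_).symm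
  refine act_tangent (w := fun i ↦ tangentBasis τ₁ τ₂ i k) hX hM ?_ ?_ <;>
    fin_cases k <;> simp [tangentBasis, mul_comm]

theorem typeGroup_le_ratAut : typeGroup v₁ v₂ ≤ ratAut (graphSet v₁ v₂) :=
  (Subgroup.closure_le _).2 fun _ h ↦ h.1

/-- The representation of `typeGroup` on the tangent plane. -/
noncomputable def tangentRep (hX : IsGHol v₁ v₂ τ₁ τ₂) :
    typeGroup v₁ v₂ →* Matrix (Fin 2) (Fin 2) ℂ where
  toFun g := tangentMap τ₁ τ₂ g
  map_one' := by
    simp [tangentMap, toC, tangentCoord_mul_tangentBasis hX.im_pos₁ hX.im_pos₂]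
  map_mul' g h := by
    have hh := toC_mul_tangentBasis hX (typeGroup_le_ratAut h.2)
    have hmul : toC (g * h : GL4) = toC g * toC h := by
      rw [toC, Units.val_mul, Matrix.map_mul]
    rw [Subgroup.coe_mul, tangentMap, hmul]
    calc _ = tangentCoord τ₁ τ₂ * toC g * (toC h * tangentBasis τ₁ τ₂) := by
          simp only [Matrix.mul_assoc]
      _ = _ := by rw [hh]; simp only [tangentMap, Matrix.mul_assoc]

theorem tangentRep_apply (hX : IsGHol v₁ v₂ τ₁ τ₂) (g : typeGroup v₁ v₂) :
    tangentRep hX g = tangentMap τ₁ τ₂ g := rfl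

theorem eq_zero_of_add_mul_eq_zero {τ : ℂ} (hτ : 0 < τ.im) {a b : ℚ} (h : (a : ℂ) + b * τ = 0) :
    a = 0 ∧ b = 0 := by
  have him := congrArg Complex.im h
  simp [hτ.ne'] at him
  subst him
  simpa using h

theorem map_mul_tangentBasis_apply
    (A : Matrix (Fin 2 ⊕ Fin 2) (Fin 2 ⊕ Fin 2) ℚ) (i : Fin 2 ⊕ Fin 2) :
    (A.map (algebraMap ℚ ℂ) * tangentBasis τ₁ τ₂) i 0 =
      ((√τ₁.im : ℝ) : ℂ)⁻¹ * (A i (Sum.inl 0) + A i (Sum.inl 1) * τ₁) ∧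
    (A.map (algebraMap ℚ ℂ) * tangentBasis τ₁ τ₂) i 1 =
      ((√τ₂.im : ℝ) : ℂ)⁻¹ * (A i (Sum.inr 0) + A i (Sum.inr 1) * τ₂) := by
  constructor <;> simp [Matrix.mul_apply, tangentBasis] <;> ring

theorem eq_zero_of_map_mul_tangentBasis (hX : IsGHol v₁ v₂ τ₁ τ₂) 
    {A : Matrix (Fin 2 ⊕ Fin 2) (Fin 2 ⊕ Fin 2) ℚ} {i : Fin 2 ⊕ Fin 2} :
    ((A.map (algebraMap ℚ ℂ) * tangentBasis τ₁ τ₂) i 0 = 0 → ∀ j, A i (Sum.inl j) = 0) ∧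
    ((A.map (algebraMap ℚ ℂ) * tangentBasis τ₁ τ₂) i 1 = 0 → ∀ j, A i (Sum.inr j) = 0) := by
  have s₁ := inv_ne_zero (sqrt_im_ne_zero hX.im_pos₁)
  have s₂ := inv_ne_zero (sqrt_im_ne_zero hX.im_pos₂)
  rw [(map_mul_tangentBasis_apply A i).1, (map_mul_tangentBasis_apply A i).2]
  constructor
  · intro h j
    obtain ⟨e0, e1⟩ := eq_zero_of_add_mul_eq_zero hX.im_pos₁ ((mul_eq_zero.1 h).resolve_left s₁)
    fin_cases j
    exacts [e0, e1]
  · intro h j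
    obtain ⟨e0, e1⟩ := eq_zero_of_add_mul_eq_zero hX.im_pos₂ ((mul_eq_zero.1 h).resolve_left s₂)
    fin_cases j
    exacts [e0, e1]

/-- Each block is determined by the corresponding entry of the matrix on the tangent plane. -/
theorem blocks_eq_zero (hX : IsGHol v₁ v₂ τ₁ τ₂) {M : GL4} (hM : M ∈ ratAut (graphSet v₁ v₂)) :
    (tangentMap τ₁ τ₂ M 0 0 = 0 → A₁ M = 0) ∧ (tangentMap τ₁ τ₂ M 0 1 = 0 → A₂ M = 0) ∧
      (tangentMap τ₁ τ₂ M 1 0 = 0 → A₃ M = 0) := by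
  have hE := toC_mul_tangentBasis hX hM
  have entry : ∀ i k, (toC M * tangentBasis τ₁ τ₂) i k =
      tangentBasis τ₁ τ₂ i 0 * tangentMap τ₁ τ₂ M 0 k +
        tangentBasis τ₁ τ₂ i 1 * tangentMap τ₁ τ₂ M 1 k := by
    intro i k
    rw [hE, Matrix.mul_apply, Fin.sum_univ_two]
  have hl : ∀ i, tangentBasis τ₁ τ₂ (Sum.inl i) 1 = 0 := by
    intro i; fin_cases i <;> simp [tangentBasis]
  have hr : ∀ i, tangentBasis τ₁ τ₂ (Sum.inr i) 0 = 0 := by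
    intro i; fin_cases i <;> simp [tangentBasis]
  refine ⟨fun h ↦ ?_, fun h ↦ ?_, fun h ↦ ?_⟩ <;> ext i j
  · exact (eq_zero_of_map_mul_tangentBasis hX (i := Sum.inl i)).1 (by rw [entry, h, hl]; simp) j
  · exact (eq_zero_of_map_mul_tangentBasis hX (i := Sum.inl i)).2 (by rw [entry, h, hl]; simp) j
  · exact (eq_zero_of_map_mul_tangentBasis hX (i := Sum.inr i)).1 (by rw [entry, h, hr]; simp) j

/-- A rational matrix is determined by its restriction to the tangent plane, since `1` and `τᵢ` are
linearly independent over `ℝ`. -/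
theorem tangentRep_injective (hX : IsGHol v₁ v₂ τ₁ τ₂) : Function.Injective (tangentRep hX) := by
  rw [injective_iff_map_eq_one]
  intro g hg
  have hE := toC_mul_tangentBasis hX (typeGroup_le_ratAut g.2)
  rw [← tangentRep_apply hX, hg, Matrix.mul_one] at hE
  have h0 : (g.1.val - 1).map (algebraMap ℚ ℂ) * tangentBasis τ₁ τ₂ = 0 := by
    rw [Matrix.map_sub _ (map_sub _), Matrix.sub_mul, hE, Matrix.map_one _ (map_zero _) (map_one _),
      Matrix.one_mul, sub_self]
  refine Subtype.ext (Units.ext (sub_eq_zero.1 ?_))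
  ext i (j | j)
  · exact (eq_zero_of_map_mul_tangentBasis hX).1 (congrFun (congrFun h0 i) 0) j
  · exact (eq_zero_of_map_mul_tangentBasis hX).2 (congrFun (congrFun h0 i) 1) j

theorem tangentRep_unitary (hX : IsGHol v₁ v₂ τ₁ τ₂) (g : typeGroup v₁ v₂) :
    (tangentRep hX g)ᴴ * tangentRep hX g = 1 := by
  have hE := toC_mul_tangentBasis hX (typeGroup_le_ratAut g.2)
  have hJ := tangentBasis_symp hX.im_pos₁ hX.im_pos₂
  have hg : (toC g)ᴴ * symp₄.map (algebraMap ℚ ℂ) * toC g = symp₄.map (algebraMap ℚ ℂ) := by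
    have hH : (toC g)ᴴ = (g.1.valᵀ).map (algebraMap ℚ ℂ) := by
      ext i j; simp
    rw [hH, ← Matrix.map_mul, ← Matrix.map_mul, isSymplectic_of_mem_typeGroup g.2]
  rw [tangentRep_apply]
  have h : (2 * I) • ((tangentMap τ₁ τ₂ g)ᴴ * tangentMap τ₁ τ₂ g) =
      (2 * I) • (1 : Matrix (Fin 2) (Fin 2) ℂ) := by
    calc _ = (tangentMap τ₁ τ₂ g)ᴴ * ((2 * I) • 1) * tangentMap τ₁ τ₂ g := by simp
      _ = (tangentBasis τ₁ τ₂ * tangentMap τ₁ τ₂ g)ᴴ * symp₄.map (algebraMap ℚ ℂ) *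
            (tangentBasis τ₁ τ₂ * tangentMap τ₁ τ₂ g) := by
          rw [← hJ, Matrix.conjTranspose_mul]; simp only [Matrix.mul_assoc]
      _ = (tangentBasis τ₁ τ₂)ᴴ * ((toC g)ᴴ * symp₄.map (algebraMap ℚ ℂ) * toC g) *
            tangentBasis τ₁ τ₂ := by
          rw [← hE, Matrix.conjTranspose_mul]; simp only [Matrix.mul_assoc]
      _ = _ := by rw [hg, hJ]
  exact smul_right_injective _ (by simp) h

/-! ### Diagonal entries, the matrices `±ι`, and polynomial relations -/

theorem exists_rat_of_mem_adjoin {τ : ℂ}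
    (h : τ ∈ IntermediateField.adjoin ℚ ({Complex.I} : Set ℂ)) :
    ∃ q r : ℚ, τ = q + r * I := by
  induction h using IntermediateField.adjoin_induction with
  | mem x hx => exact ⟨0, 1, by simpa using hx⟩
  | algebraMap x => exact ⟨x, 0, by simp⟩
  | add x y _ _ hx hy =>
    obtain ⟨q, r, rfl⟩ := hx
    obtain ⟨q', r', rfl⟩ := hy
    exact ⟨q + q', r + r', by push_cast; ring⟩
  | inv x _ hx =>
    obtain ⟨q, r, rfl⟩ := hx
    refine ⟨q / (q ^ 2 + r ^ 2), -r / (q ^ 2 + r ^ 2), ?_⟩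
    rw [Complex.inv_def, normSq_apply]
    simp
    ring
  | mul x y _ _ hx hy =>
    obtain ⟨q, r, rfl⟩ := hx
    obtain ⟨q', r', rfl⟩ := hy
    exact ⟨q * q' - r * r', q * r' + r * q', by
      push_cast; linear_combination (r : ℂ) * r' * I_sq⟩

theorem tendsto_params :
    Filter.Tendsto (fun x : C4 ↦ (x (Sum.inl 0), x (Sum.inr 0))) (𝓝 0) (𝓝 0) :=
  (by fun_prop : Continuous fun x : C4 ↦ (x (Sum.inl 0), x (Sum.inr 0))).tendsto 0

theorem neg_one_mem_typeGroup (hX : IsGHol v₁ v₂ τ₁ τ₂) : (-1 : GL4) ∈ typeGroup v₁ v₂ := by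
  refine Subgroup.subset_closure ⟨?_, Or.inl ?_⟩
  · change ∀ᶠ x in 𝓝 (0 : C4), act (-1) x ∈ graphSet v₁ v₂ ↔ x ∈ graphSet v₁ v₂
    filter_upwards [tendsto_params.eventually hX.odd₁, tendsto_params.eventually hX.odd₂]
      with x h₁ h₂
    have : act (-1) x = -x := by
      ext i; rcases i with i | i <;> fin_cases i <;> simp [act, Matrix.mulVec, dotProduct]
    rw [Prod.neg_mk] at h₁ h₂
    simp [this, graphSet, h₁, h₂]
  · have h : (-1 : GL4).val = Matrix.fromBlocks (-1) 0 0 (-1) := by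
      rw [Units.val_neg, Units.val_one, ← Matrix.fromBlocks_one, Matrix.fromBlocks_neg, neg_zero]
    refine ⟨?_, ?_, ?_, ?_⟩ <;> simp [A₁, A₂, A₃, A₄, h, Matrix.det_neg]

theorem iota_mem_typeGroup (hX : IsGHol v₁ v₂ τ₁ τ₂) : iota ∈ typeGroup v₁ v₂ := by
  refine Subgroup.subset_closure ⟨?_, Or.inl ?_⟩
  · change ∀ᶠ x in 𝓝 (0 : C4), act iota x ∈ graphSet v₁ v₂ ↔ x ∈ graphSet v₁ v₂
    filter_upwards [tendsto_params.eventually hX.symm₁₂, tendsto_params.eventually hX.symm₂₂]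
      with x h₁ h₂
    have e : ∀ i, act iota x (Sum.inl i) = x (Sum.inl i) ∧
        act iota x (Sum.inr i) = -x (Sum.inr i) := by
      intro i; fin_cases i <;> simp [act, iota, Matrix.mulVec, dotProduct]
    simp [graphSet, e, h₁, h₂]
  · refine ⟨?_, ?_, ?_, ?_⟩ <;> simp [A₁, A₂, A₃, A₄, iota, Matrix.det_neg]

theorem tangentMap_apply_diag (hX : IsGHol v₁ v₂ τ₁ τ₂) (M : GL4) :
    tangentMap τ₁ τ₂ M 0 0 =
      M.val (Sum.inl 0) (Sum.inl 0) + M.val (Sum.inl 0) (Sum.inl 1) * τ₁ ∧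
    tangentMap τ₁ τ₂ M 1 1 =
      M.val (Sum.inr 0) (Sum.inr 0) + M.val (Sum.inr 0) (Sum.inr 1) * τ₂ := by
  have := sqrt_im_ne_zero hX.im_pos₁
  have := sqrt_im_ne_zero hX.im_pos₂
  rw [tangentMap, Matrix.mul_assoc]
  constructor <;> rw [Matrix.mul_apply] <;>
    simp [map_mul_tangentBasis_apply, tangentCoord, *]

theorem gaussianRep_tangentRep (hX : IsGHol v₁ v₂ τ₁ τ₂)
    (hτ₁ : τ₁ ∈ IntermediateField.adjoin ℚ ({Complex.I} : Set ℂ))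
    (hτ₂ : τ₂ ∈ IntermediateField.adjoin ℚ ({Complex.I} : Set ℂ)) :
    GaussianRep (tangentRep hX) ⟨iota, iota_mem_typeGroup hX⟩ ⟨-1, neg_one_mem_typeGroup hX⟩ where
  injective := tangentRep_injective hX
  unitary := tangentRep_unitary hX
  diag g i := by
    rw [tangentRep_apply]
    obtain ⟨h0, h1⟩ := tangentMap_apply_diag hX (g : GL4)
    fin_cases i
    · obtain ⟨q, r, hqr⟩ := exists_rat_of_mem_adjoin hτ₁
      refine ⟨g.1.val (Sum.inl 0) (Sum.inl 0) + g.1.val (Sum.inl 0) (Sum.inl 1) * q,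
        g.1.val (Sum.inl 0) (Sum.inl 1) * r, ?_⟩
      refine h0.trans ?_
      rw [hqr]; push_cast; ring
    · obtain ⟨q, r, hqr⟩ := exists_rat_of_mem_adjoin hτ₂
      refine ⟨g.1.val (Sum.inr 0) (Sum.inr 0) + g.1.val (Sum.inr 0) (Sum.inr 1) * q,
        g.1.val (Sum.inr 0) (Sum.inr 1) * r, ?_⟩
      refine h1.trans ?_
      rw [hqr]; push_cast; ring
  map_iota := by
    have := sqrt_im_ne_zero hX.im_pos₁
    have := sqrt_im_ne_zero hX.im_pos₂
    rw [tangentRep_apply]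
    ext i j
    fin_cases i <;> fin_cases j <;>
      simp [tangentMap, Matrix.mul_apply, tangentCoord, tangentBasis, iota, *]
  map_neg := by
    have h : toC (-1) = -1 := by
      rw [toC, Units.val_neg, Units.val_one, Matrix.map_neg _ (map_neg _),
        Matrix.map_one _ (map_zero _) (map_one _)]
    rw [tangentRep_apply, tangentMap, h, Matrix.mul_neg, Matrix.mul_one, Matrix.neg_mul,
      tangentCoord_mul_tangentBasis hX.im_pos₁ hX.im_pos₂]

theorem entries_ne_zero_of_typeIII (hX : IsGHol v₁ v₂ τ₁ τ₂) {M : typeGroup v₁ v₂}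
    (hM : TypeIII M) : tangentRep hX M 0 0 ≠ 0 ∧ tangentRep hX M 0 1 ≠ 0 := by
  obtain ⟨h1, h2, -⟩ := blocks_eq_zero hX (typeGroup_le_ratAut M.2)
  obtain ⟨⟨n1, n2, -, -⟩, -⟩ := hM
  refine ⟨fun h ↦ n1 ?_, fun h ↦ n2 ?_⟩
  · rw [h1 h]; simp
  · rw [h2 h]; simp

/-- Polynomial relations between an element of the group and rational scalars pass to the tangent
plane. -/
theorem aeval_tangentRep (hX : IsGHol v₁ v₂ τ₁ τ₂) (M : typeGroup v₁ v₂) {p : ℚ[X]}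
    (hp : p = minPoly M) : aeval (tangentRep hX M) p = 0 := by
  have h0 : aeval M.1.val p = 0 := by rw [hp]; exact minpoly.aeval ℚ _
  have hpow : ∀ n : ℕ, tangentCoord τ₁ τ₂ * (M.1.val ^ n).map (algebraMap ℚ ℂ) *
      tangentBasis τ₁ τ₂ = tangentRep hX M ^ n := by
    intro n
    rw [← map_pow]
    rfl
  have hlin : ∀ q : ℚ[X], tangentCoord τ₁ τ₂ * (aeval M.1.val q).map (algebraMap ℚ ℂ) *
      tangentBasis τ₁ τ₂ = aeval (tangentRep hX M) q := by
    intro q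
    induction q using Polynomial.induction_on' with
    | add q r hq hr =>
      rw [map_add, map_add, Matrix.map_add _ (map_add _), Matrix.mul_add, Matrix.add_mul, hq, hr]
    | monomial n a =>
      rw [aeval_monomial, aeval_monomial, ← Algebra.smul_def, ← Algebra.smul_def, ← hpow]
      have : (a • M.1.val ^ n).map (algebraMap ℚ ℂ) =
          a • (M.1.val ^ n).map (algebraMap ℚ ℂ) := by
        ext i j; simp [Rat.smul_def]
      rw [this, Matrix.mul_smul, Matrix.smul_mul]
  rw [← hlin, h0]
  simp
end
end GHol

/-! ### The two cases of the theorem -/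

theorem theorem9p7 (v₁ v₂ : ℂ × ℂ → ℂ) (τ₁ τ₂ : ℂ)
    (hX : GHol.IsGHol v₁ v₂ τ₁ τ₂)
    (hτ₁ : τ₁ ∈ IntermediateField.adjoin ℚ ({Complex.I} : Set ℂ))
    (hτ₂ : τ₂ ∈ IntermediateField.adjoin ℚ ({Complex.I} : Set ℂ)) :
    (∀ M ∈ GHol.typeGroup v₁ v₂, GHol.TypeIII M → GHol.minPoly M = X ^ 2 + 1 →
      GHol.typeGroup v₁ v₂ = Subgroup.closure {M, GHol.iota, -GHol.iota} ∧
      (GHol.typeGroup v₁ v₂ : Set GHol.GL4) =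
        {g | ∃ ε₁ α ε₂ : ℕ, ε₁ ≤ 1 ∧ α ≤ 5 ∧ ε₂ ≤ 1 ∧
          (g = GHol.iota ^ ε₁ * (GHol.iota * M) ^ α * GHol.iota ^ ε₂ ∨
           g = -(GHol.iota ^ ε₁ * (GHol.iota * M) ^ α * GHol.iota ^ ε₂))}) ∧
    (∀ M ∈ GHol.typeGroup v₁ v₂, ∀ N ∈ GHol.typeGroup v₁ v₂,
      GHol.TypeIII M → GHol.TypeIII N →
      (GHol.minPoly M = X ^ 3 + X ^ 2 + X + 1 ∨ GHol.minPoly M = X ^ 3 - X ^ 2 + X - 1) →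
      GHol.minPoly N = X ^ 4 - X ^ 2 + 1 →
      (GHol.minPoly (GHol.iota * N) = X ^ 2 + X + 1 ∨
        GHol.minPoly (GHol.iota * N) = X ^ 2 - X + 1) →
      GHol.typeGroup v₁ v₂ = Subgroup.closure {M, N, GHol.iota, -GHol.iota} ∧
      ∃ H : Subgroup GHol.GL4, H ≤ GHol.typeGroup v₁ v₂ ∧ IsMulCommutative H ∧
        Nat.card H = 16 ∧ (∀ η ∈ H, GHol.TypeI η) ∧
        (GHol.typeGroup v₁ v₂ : Set GHol.GL4) =
          {g | ∃ η₁ ∈ H, ∃ η₂ ∈ H, ∃ α : ℕ, α ≤ 2 ∧ g = η₁ * M ^ α * η₂}) := by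
  have hρ := GHol.gaussianRep_tangentRep hX hτ₁ hτ₂
  have hfin : Finite (GHol.typeGroup v₁ v₂) :=
    (hX.finite_aut _ GHol.typeGroup_le_ratAut).to_subtype
  have hι := GHol.iota_mem_typeGroup hX
  have hz := GHol.neg_one_mem_typeGroup hX
  refine ⟨fun M hM hIII hmin ↦ ?_, fun M hM N hN hMIII hNIII hminM hminN hminι ↦ ?_⟩
  · obtain ⟨ha, hb⟩ := GHol.entries_ne_zero_of_typeIII hX (M := ⟨M, hM⟩) hIII
    have hsq : (⟨M, hM⟩ : GHol.typeGroup v₁ v₂) ^ 2 = ⟨-1, hz⟩ := by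
      apply hρ.injective
      have h := GHol.aeval_tangentRep hX ⟨M, hM⟩ hmin.symm
      simp at h
      rw [map_pow, hρ.map_neg]
      exact eq_neg_of_add_eq_zero_left h
    have form : ∀ g ∈ GHol.typeGroup v₁ v₂, ∃ ε₁ α ε₂ : ℕ, ε₁ ≤ 1 ∧ α ≤ 5 ∧ ε₂ ≤ 1 ∧
        (g = GHol.iota ^ ε₁ * (GHol.iota * M) ^ α * GHol.iota ^ ε₂ ∨
          g = -(GHol.iota ^ ε₁ * (GHol.iota * M) ^ α * GHol.iota ^ ε₂)) := by
      intro g hg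
      obtain ⟨ε₁, α, ε₂, h₁, h₂, h₃, h⟩ := hρ.exists_eq_of_sq_eq_neg ha hb hsq ⟨g, hg⟩
      refine ⟨ε₁, α, ε₂, h₁, h₂, h₃, h.imp (fun h ↦ ?_) (fun h ↦ ?_)⟩
      · simpa using congrArg Subtype.val h
      · simpa using congrArg Subtype.val h
    have mem : ∀ K : Subgroup GHol.GL4, M ∈ K → GHol.iota ∈ K → -GHol.iota ∈ K →
        ∀ ε₁ α ε₂ : ℕ, GHol.iota ^ ε₁ * (GHol.iota * M) ^ α * GHol.iota ^ ε₂ ∈ K ∧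
          -(GHol.iota ^ ε₁ * (GHol.iota * M) ^ α * GHol.iota ^ ε₂) ∈ K := by
      intro K hMK hιK hnK ε₁ α ε₂
      have h := mul_mem (mul_mem (pow_mem hιK ε₁) (pow_mem (mul_mem hιK hMK) α))
        (pow_mem hιK ε₂)
      refine ⟨h, ?_⟩
      have h1 : -GHol.iota * GHol.iota⁻¹ ∈ K := mul_mem hnK (inv_mem hιK)
      rw [neg_mul, mul_inv_cancel] at h1
      simpa using mul_mem h1 h
    have hnι : -GHol.iota ∈ GHol.typeGroup v₁ v₂ := by simpa using mul_mem hz hι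
    refine ⟨le_antisymm ?_ ?_, Set.Subset.antisymm form ?_⟩
    · intro g hg
      have hm := mem (Subgroup.closure {M, GHol.iota, -GHol.iota})
        (Subgroup.subset_closure (by simp)) (Subgroup.subset_closure (by simp))
        (Subgroup.subset_closure (by simp))
      obtain ⟨ε₁, α, ε₂, -, -, -, rfl | rfl⟩ := form g hg
      exacts [(hm ε₁ α ε₂).1, (hm ε₁ α ε₂).2]
    · rw [Subgroup.closure_le]
      rintro g (rfl | rfl | rfl)
      exacts [hM, hι, hnι]
    · rintro g ⟨ε₁, α, ε₂, -, -, -, rfl | rfl⟩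
      exacts [(mem _ hM hι hnι ε₁ α ε₂).1, (mem _ hM hι hnι ε₁ α ε₂).2]
  · obtain ⟨-, hb⟩ := GHol.entries_ne_zero_of_typeIII hX (M := ⟨M, hM⟩) hMIII
    obtain ⟨-, hbN⟩ := GHol.entries_ne_zero_of_typeIII hX (M := ⟨N, hN⟩) hNIII
    have hcubic : ∃ ε : ℂ, ε ^ 2 = 1 ∧ GHol.tangentRep hX ⟨M, hM⟩ ^ 3 +
        ε • GHol.tangentRep hX ⟨M, hM⟩ ^ 2 + GHol.tangentRep hX ⟨M, hM⟩ + ε • 1 = 0 := by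
      rcases hminM with h | h
      · have h := GHol.aeval_tangentRep hX ⟨M, hM⟩ h.symm
        simp at h
        exact ⟨1, by norm_num, by simpa using h⟩
      · have h := GHol.aeval_tangentRep hX ⟨M, hM⟩ h.symm
        simp at h
        exact ⟨-1, by norm_num, by simpa [sub_eq_add_neg] using h⟩
    have hιN : ∃ ε : ℂ, ε ^ 2 = 1 ∧ GHol.tangentRep hX (⟨GHol.iota, hι⟩ * ⟨N, hN⟩) ^ 2 +
        ε • GHol.tangentRep hX (⟨GHol.iota, hι⟩ * ⟨N, hN⟩) + 1 = 0 := by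
      rcases hminι with h | h
      · have h := GHol.aeval_tangentRep hX (⟨GHol.iota, hι⟩ * ⟨N, hN⟩) h.symm
        simp only [map_add, map_pow, aeval_X, map_one] at h
        exact ⟨1, by norm_num, by simpa only [one_smul] using h⟩
      · have h := GHol.aeval_tangentRep hX (⟨GHol.iota, hι⟩ * ⟨N, hN⟩) h.symm
        simp only [map_add, map_sub, map_pow, aeval_X, map_one] at h
        exact ⟨-1, by norm_num, by simpa only [neg_smul, one_smul, sub_eq_add_neg] using h⟩
    have hquartic : GHol.tangentRep hX ⟨N, hN⟩ ^ 4 - GHol.tangentRep hX ⟨N, hN⟩ ^ 2 + 1 = 0 := by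
      have h := GHol.aeval_tangentRep hX ⟨N, hN⟩ hminN.symm
      simpa using h
    -- otherwise `x ^ 2 + 1`, of degree less than `3`, would kill `M`
    have hMz : (⟨M, hM⟩ : GHol.typeGroup v₁ v₂) ^ 2 ≠ ⟨-1, hz⟩ := by
      intro h
      have hval : M.val ^ 2 = -1 := by
        have := congrArg (fun g : GHol.typeGroup v₁ v₂ ↦ (g : GHol.GL4).val) h
        simpa using this
      have hle := minpoly.min ℚ M.val (p := X ^ 2 + 1) (by monicity!) (by simp [hval])
      have h2 : (X ^ 2 + 1 : ℚ[X]).degree = 2 := by compute_degree!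
      have h3 : (minpoly ℚ M.val).degree = 3 := by
        rcases hminM with h | h <;> rw [show minpoly ℚ M.val = _ from h] <;> compute_degree!
      rw [h2, h3] at hle
      exact absurd hle (by decide)
    obtain ⟨ε, hε, hcubic⟩ := hcubic
    obtain ⟨ε', hε', hιN⟩ := hιN
    obtain ⟨hcard, hform, htop⟩ :=
      hρ.structure_of_cubic_quartic hb hε hcubic hMz hbN hε' hquartic hιN
    have hnι : -GHol.iota ∈ GHol.typeGroup v₁ v₂ := by simpa using mul_mem hz hι
    refine ⟨le_antisymm ?_ ?_, hρ.diagonalSubgroup.map (GHol.typeGroup v₁ v₂).subtype, ?_, ?_, ?_,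
      ?_, ?_⟩
    · rw [← Subgroup.subgroupOf_eq_top]
      apply htop <;> exact Subgroup.subset_closure (by simp)
    · rw [Subgroup.closure_le]
      rintro g (rfl | rfl | rfl | rfl)
      exacts [hM, hN, hι, hnι]
    · rintro _ ⟨g, -, rfl⟩
      exact g.2
    · have := hρ.isMulCommutative_diagonalSubgroup
      infer_instance
    · rw [Subgroup.card_map_of_injective (Subgroup.subtype_injective _), hcard]
    · rintro _ ⟨g, hg, rfl⟩
      obtain ⟨-, h2, h3⟩ := GHol.blocks_eq_zero hX (GHol.typeGroup_le_ratAut g.2)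
      have hd := hρ.eq_diagonal_of_mem hg
      refine GHol.typeI_of_isSymplectic (GHol.isSymplectic_of_mem_typeGroup g.2) (h2 hg) (h3 ?_)
      exact congrFun (congrFun hd 1) 0
    · ext g
      constructor
      · intro hg
        obtain ⟨η₁, h₁, η₂, h₂, α, hα, h⟩ := hform ⟨g, hg⟩
        exact ⟨η₁, ⟨η₁, h₁, rfl⟩, η₂, ⟨η₂, h₂, rfl⟩, α, hα, congrArg Subtype.val h⟩
      · rintro ⟨_, ⟨η₁, -, rfl⟩, _, ⟨η₂, -, rfl⟩, α, -, rfl⟩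
        exact mul_mem (mul_mem η₁.2 (pow_mem hM α)) η₂.2
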